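/- \textbf{Notation.} Let $\mathcal H$ be the upper half plane, and let $\sqrt{\cdot}$ be the principal branch of the square root. For $\tau\in\mathcal H$ and $z,u,v\in\mathbb C$ put $$\vartheta(z;\tau)=\sum_{n\in\mathbb Z+\frac12}e^{\pi i n^2\tau+2\pi i n(z+\frac12)},\qquad E(x)=2\int_0^x e^{-\pi w^2}\,dw ,$$ $$R(u;\tau)=\sum_{n\in\mathbb Z+\frac12}\Big(\operatorname{sgn}(n)-E\big((n+\tfrac{\operatorname{Im}u}{\operatorname{Im}\tau})\sqrt{2\operatorname{Im}\tau}\big)\Big)(-1)^{n-\frac12}e^{-\pi i n^2\tau-2\pi i n u},$$ and, for $u,v\notin\mathbb Z+\tau\mathbb Z$, $$\mu(u,v;\tau)=\frac{e^{\pi i u}}{\vartheta(v;\tau)}\sum_{n\in\mathbb Z}\frac{(-1)^n e^{\pi i n(n+1)\tau+2\pi i n v}}{1-e^{2\pi i n\tau+2\pi i u}},\qquad \tilde\mu(u,v;\tau)=\mu(u,v;\tau)+\tfrac i2R(u-v;\tau).$$ For integers $a,c$ with $c>0$ and $c\nmid 2a$ put $$N(a,c;\tau)=e^{-\pi i\tau/2}\,\tilde\mu\left(\tfrac{2a}{c},\tau;2\tau\right).$$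 For $A=\begin{pmatrix}\alpha&\beta\\ \gamma&\delta\end{pmatrix}\in\mathrm{SL}_2(\mathbb Z)$ write $A\tau=\frac{\alpha\tau+\beta}{\gamma\tau+\delta}$, and let $\nu(A)$ be the constant such that $\eta(A\tau)=\nu(A)\sqrt{\gamma\tau+\delta}\,\eta(\tau)$ for all $\tau\in\mathcal H$, where $\eta(\tau)=e^{\pi i\tau/12}\prod_{n\ge1}(1-e^{2\pi i n\tau})$. Finally put $${}^2A=\begin{pmatrix}\alpha&2\beta\\ \gamma/2&\delta\end{pmatrix}\ \text{ if }\gamma\text{ is even},\qquad {}_2A=\begin{pmatrix}2\alpha&\beta\\ \gamma&\delta/2\end{pmatrix}\ \text{ if }\delta\text{ is even};$$ these are elements of $\mathrm{SL}_2(\mathbb Z)$. \textbf{Proposition.} Let $a,c$ be integers with $c>0$ and $c\nmid 2a$, let $A=\begin{pmatrix}\alpha&\beta\\ \gamma&\delta\end{pmatrix}\in\mathrm{SL}_2(\mathbb Z)$ and $\tau\in\mathcal H$. (1) If $\gamma$ is even, then $$N(a,c;A\tau)=\nu({}^2A)^{-3}(-1)^{\beta+\frac{\alpha-1}{2}} \exp\left(-\pi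 i\left(\tfrac{2a^2\gamma\delta}{c^2}+\tfrac{2a}{c}+\tfrac{\alpha\beta}{2}-\tfrac{2a\delta}{c}\right)\right) \exp\left(-\pi i\tau\left(\tfrac{2a^2\gamma^2}{c^2}-\tfrac{2a\gamma}{c}+\tfrac12\right)\right) \sqrt{\gamma\tau+\delta}\;\tilde\mu\left(\tfrac{2a\delta}{c}+\tfrac{2a\gamma\tau}{c},\tau;2\tau\right).$$ (2) If $\gamma$ is odd and $\delta$ is even, then $$N(a,c;A\tau)=2^{-\frac12}\,\nu({}_2A)^{-3} \exp\left(-\pi i\left(\tfrac{2a^2\gamma\delta}{c^2}-\tfrac{2a\beta\gamma}{c}+\tfrac{\alpha\beta}{2}\right)\right) \exp\left(-\pi i\tau\left(\tfrac{2a^2\gamma^2}{c^2}-\tfrac{2a\alpha\gamma}{c}+\tfrac{\alpha^2}{2}\right)\right) \sqrt{\gamma\tau+\delta}\;\tilde\mu\left(\tfrac{a\delta}{c}+\tfrac{a\gamma\tau}{c},\tfrac{\alpha\tau}{2}+\tfrac{\beta}{2};\tfrac{\tau}{2}\right).$$ -/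

import Mathlib

open scoped UpperHalfPlane MatrixGroups Real
open Complex (exp I)

noncomputable section

namespace ZwegersMu

/-- The theta function `ϑ(z;τ) = ∑_{n ∈ ℤ + 1/2} exp(πi n² τ + 2πi n (z + 1/2))`; the summation
variable is `n = k + 1/2` with `k ∈ ℤ`. -/
def vartheta (z τ : ℂ) : ℂ :=
  ∑' k : ℤ, exp (π * I * ((k : ℂ) + 1 / 2) ^ 2 * τ
    + 2 * π * I * ((k : ℂ) + 1 / 2) * (z + 1 / 2))

/-- The Appell–Lerch sum `μ(u,v;τ)`, meaningful for `u, v ∉ ℤ + τℤ`. -/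
def mu (u v τ : ℂ) : ℂ :=
  exp (π * I * u) / vartheta v τ *
    ∑' n : ℤ, (-1 : ℂ) ^ n * exp (π * I * n * (n + 1) * τ + 2 * π * I * n * v)
      / (1 - exp (2 * π * I * n * τ + 2 * π * I * u))

/-- `E(x) = 2 ∫₀ˣ exp(-π w²) dw`, which is needed only at real arguments. -/
def E (x : ℝ) : ℝ :=
  2 * ∫ w in (0 : ℝ)..x, Real.exp (-π * w ^ 2)

/-- `R(u;τ) = ∑_{n ∈ ℤ + 1/2} (sgn n - E((n + b) √(2y))) (-1)^{n - 1/2} exp(-πi n² τ - 2πi n u)`,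
where `y = Im τ` and `b = Im u / Im τ`; the summation variable is `n = k + 1/2` with `k ∈ ℤ`. -/
def R (u τ : ℂ) : ℂ :=
  ∑' k : ℤ,
    ((Real.sign ((k : ℝ) + 1 / 2)
        - E (((k : ℝ) + 1 / 2 + u.im / τ.im) * √(2 * τ.im)) : ℝ) : ℂ)
      * (-1 : ℂ) ^ k
      * exp (-π * I * ((k : ℂ) + 1 / 2) ^ 2 * τ - 2 * π * I * ((k : ℂ) + 1 / 2) * u)

/-- Zwegers' completion `μ̃(u,v;τ) = μ(u,v;τ) + (i/2) R(u - v;τ)`. -/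
def muTilde (u v τ : ℂ) : ℂ :=
  mu u v τ + I / 2 * R (u - v) τ

/-- `N(a,c;τ) = q^{-1/4} μ̃(2a/c, τ; 2τ)` with `q = exp(2πiτ)`. -/
def N (a c : ℤ) (τ : ℍ) : ℂ :=
  exp (-π * I * τ / 2) * muTilde (2 * a / c) τ (2 * τ)

/-- The `η`-multiplier `ν(A)`, that is the constant for which
`η(Aτ) = ν(A) √(γτ + δ) η(τ)` holds for all `τ` in the upper half plane (`etaMultiplier_spec`);
the constant is read off at `τ = i`. -/
def etaMultiplier (A : SL(2, ℤ)) : ℂ :=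
  ModularForm.eta ((A • UpperHalfPlane.I : ℍ) : ℂ) /
    (Complex.sqrt ((A 1 0 : ℂ) * I + (A 1 1 : ℂ)) * ModularForm.eta I)

lemma sqrt_pow24 {z : ℂ} (hz : z ≠ 0) : Complex.sqrt z ^ 24 = z ^ 12 := by
  rw [sqrt_eq_exp hz, ← Complex.exp_nat_mul]
  have : ((24 : ℕ) : ℂ) * (Complex.log z / 2) = (12 : ℕ) * Complex.log z := by
    push_cast; ring
  rw [this, Complex.exp_nat_mul, Complex.exp_log hz]

lemma eta_smul_pow24 (A : SL(2, ℤ)) (τ : ℍ) :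
    ModularForm.eta ((A • τ : ℍ) : ℂ) ^ 24 =
      ((A 1 0 : ℂ) * τ + (A 1 1 : ℂ)) ^ 12 * ModularForm.eta τ ^ 24 := by
  have h := congrFun (SlashInvariantForm.slash_action_generators_SL2Z
    ModularForm.discriminant_S_invariant ModularForm.discriminant_T_invariant A) τ
  rw [ModularForm.SL_slash_apply, zpow_neg, ← div_eq_mul_inv,
    div_eq_iff (zpow_ne_zero _ (UpperHalfPlane.denom_ne_zero _ _))] at h
  simp only [ModularForm.discriminant, ModularGroup.denom_apply] at h
  rw [h, mul_comm]
  norm_cast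

/-- The defining property of the `η`-multiplier. -/
theorem etaMultiplier_spec (A : SL(2, ℤ)) (τ : ℍ) :
    ModularForm.eta ((A • τ : ℍ) : ℂ) =
      etaMultiplier A * Complex.sqrt ((A 1 0 : ℂ) * τ + (A 1 1 : ℂ)) * ModularForm.eta τ := by
  have hd (z : ℍ) : (A 1 0 : ℂ) * z + (A 1 1 : ℂ) ≠ 0 := by
    rw [← ModularGroup.denom_apply]
    exact UpperHalfPlane.denom_ne_zero _ _
  have hs (z : ℍ) : Complex.sqrt ((A 1 0 : ℂ) * z + (A 1 1 : ℂ)) ≠ 0 := by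
    rw [sqrt_eq_exp (hd z)]
    exact Complex.exp_ne_zero _
  have he (z : ℍ) : ModularForm.eta z ≠ 0 := ModularForm.eta_ne_zero z.2
  have hce : Continuous fun z : ℍ ↦ ModularForm.eta z := continuous_iff_continuousAt.2 fun z ↦
    (ModularForm.differentiableAt_eta_of_mem_upperHalfPlaneSet z.2).continuousAt.comp
      UpperHalfPlane.continuous_coe.continuousAt
  have hcs : Continuous fun z : ℍ ↦ Complex.sqrt ((A 1 0 : ℂ) * z + (A 1 1 : ℂ)) := by
    by_cases h0 : A 1 0 = 0
    · simpa [h0] using continuous_const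
    · refine continuous_iff_continuousAt.2 fun z ↦ ?_
      refine ContinuousAt.comp (g := Complex.sqrt) (Complex.differentiableAt_sqrt ?_).continuousAt
        ((continuous_const.mul UpperHalfPlane.continuous_coe).add continuous_const).continuousAt
      refine Complex.mem_slitPlane_iff.2 (Or.inr ?_)
      simpa [z.im_ne_zero] using h0
  have hca : Continuous fun z : ℍ ↦ (A • z : ℍ) := by
    have := continuous_const_smul (T := ℍ)
      (Matrix.SpecialLinearGroup.map (n := Fin 2) (Int.castRingHom ℝ) A)
    exact this
  let f : ℍ → ℂ := fun z ↦ ModularForm.eta ((A • z : ℍ) : ℂ) /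
    (Complex.sqrt ((A 1 0 : ℂ) * z + (A 1 1 : ℂ)) * ModularForm.eta z)
  have hf : Continuous f := (hce.comp hca).div (hcs.mul hce) fun z ↦ mul_ne_zero (hs z) (he z)
  have hf24 (z : ℍ) : f z ∈ {w : ℂ | w ^ 24 = 1} := by
    change (_ / _) ^ 24 = (1 : ℂ)
    rw [div_pow, mul_pow, eta_smul_pow24, sqrt_pow24 (hd z)]
    exact div_self (mul_ne_zero (pow_ne_zero _ (hd z)) (pow_ne_zero _ (he z)))
  have hfin : {w : ℂ | w ^ 24 = 1}.Finite := by
    refine (Polynomial.nthRoots 24 (1 : ℂ)).toFinset.finite_toSet.subset fun w hw ↦ ?_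
    simpa [Polynomial.mem_nthRoots] using hw
  have hconst : f τ = f UpperHalfPlane.I :=
    isPreconnected_univ.constant_of_mapsTo hfin.isDiscrete hf.continuousOn
      (fun z _ ↦ hf24 z) (Set.mem_univ _) (Set.mem_univ _)
  have hI : f UpperHalfPlane.I = etaMultiplier A := by
    simp [f, etaMultiplier]
  rw [← hI, ← hconst]
  simp only [f]
  field_simp [hs τ, he τ]

/-- `ᵐA = (α, mβ; γ/m, δ)` for `A = (α, β; γ, δ)` with `m ∣ γ`. -/
def upperTwist (m : ℤ) (A : SL(2, ℤ)) (h : m ∣ A 1 0) : SL(2, ℤ) :=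
  ⟨!![A 0 0, m * A 0 1; A 1 0 / m, A 1 1], by
    have h1 := Matrix.det_fin_two A.1
    rw [A.2] at h1
    rw [Matrix.det_fin_two_of]
    have h2 : m * (A 1 0 / m) = A 1 0 := Int.mul_ediv_cancel' h
    linear_combination (-A 0 1) * h2 - h1⟩

/-- `ₘA = (mα, β; γ, δ/m)` for `A = (α, β; γ, δ)` with `m ∣ δ`. -/
def lowerTwist (m : ℤ) (A : SL(2, ℤ)) (h : m ∣ A 1 1) : SL(2, ℤ) :=
  ⟨!![m * A 0 0, A 0 1; A 1 0, A 1 1 / m], by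
    have h1 := Matrix.det_fin_two A.1
    rw [A.2] at h1
    rw [Matrix.det_fin_two_of]
    have h2 : m * (A 1 1 / m) = A 1 1 := Int.mul_ediv_cancel' h
    linear_combination (A 0 0) * h2 - h1⟩

end ZwegersMu

end

noncomputable section

namespace ZwegersMu

open Filter Topology
open scoped ComplexConjugate

/-! The value N(a,c;Aτ) is, up to an exponential, `muTilde` at modulus 2Aτ. Put B = ²A acting on 2τ
when γ is even, or B = ₂A acting on τ/2 when δ is even; in both cases the image point is 2Aτ. The
proposition is therefore the modular law of `muTilde` under B (`muTilde_smul`), taken at u = (2a/c)j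
and v = Aτ·j with j the automorphy factor of B. For even γ, v is an integer multiple of 2τ plus an
integer away from τ, and the elliptic laws of `muTilde` remove that shift.

For the modular law, the `η`-multiplier is absorbed first: `η³ μ̃` transforms with the pure
weight-two factor j² times an exponential, and this law passes to products and inverses
(`TransformsUnder`). It remains to treat T, which is a termwise computation, and S, which carries
the analysis (`muTilde_inversion`).

For S, let f(u) be the sum of μ̃(u,v;τ) and the suitably normalised μ̃(u/τ,v/τ;-1/τ). The
antiholomorphic derivative of R is a Gaussian times the conjugate of ϑ (`exists_hasFDerivAt_R`), so
the inversion formula of ϑ makes the non-holomorphic parts of f cancel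
(`differentiable_R_add_inversion`). Hence f is holomorphic off the lattice with at most simple poles
there. The inhomogeneous terms in the elliptic laws of μ and R cancel as well, so f is
quasi-periodic of degree -1. Then ϑ·f extends to an entire function which, after an exponential
twist, is bounded with constant unitary multipliers; these are not both 1 unless v is a lattice
point, so ϑ·f = 0 (`vartheta_mul_eq_zero`). The same vanishing theorem, applied to the Appell–Lerch
sum, shows that ϑ has no zeros off the lattice (`vartheta_ne_zero`), so f = 0. -/

/-! ### The lattice `ℤ + τℤ` -/

/-- The lattice `ℤ + τℤ`. -/
def lattice (τ : ℂ) : Set ℂ := {z | ∃ m n : ℤ, z = m + n * τ}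

lemma add_mem_lattice_iff {τ z : ℂ} (m n : ℤ) : z + (m + n * τ) ∈ lattice τ ↔ z ∈ lattice τ := by
  constructor
  · rintro ⟨a, b, h⟩
    exact ⟨a - m, b - n, by push_cast; linear_combination h⟩
  · rintro ⟨a, b, h⟩
    exact ⟨a + m, b + n, by push_cast; linear_combination h⟩

lemma add_one_mem_lattice_iff {τ z : ℂ} : z + 1 ∈ lattice τ ↔ z ∈ lattice τ := by
  simpa using add_mem_lattice_iff (τ := τ) (z := z) 1 0

lemma add_self_mem_lattice_iff {τ z : ℂ} : z + τ ∈ lattice τ ↔ z ∈ lattice τ := by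
  simpa using add_mem_lattice_iff (τ := τ) (z := z) 0 1

lemma mem_lattice_iff {τ : ℂ} (hτ : 0 < τ.im) (z : ℂ) :
    z ∈ lattice τ ↔ z.im / τ.im ∈ Set.range ((↑) : ℤ → ℝ) ∧
      z.re - z.im / τ.im * τ.re ∈ Set.range ((↑) : ℤ → ℝ) := by
  constructor
  · rintro ⟨m, n, rfl⟩
    have h : ((m : ℂ) + n * τ).im / τ.im = n := by simp [hτ.ne']
    rw [h]
    exact ⟨⟨n, rfl⟩, ⟨m, by simp⟩⟩
  · rintro ⟨⟨n, hn⟩, ⟨m, hm⟩⟩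
    refine ⟨m, n, ?_⟩
    rw [← hn] at hm
    rw [eq_div_iff hτ.ne'] at hn
    apply Complex.ext
    · simp [hm]
    · simp [hn]

lemma isClosed_lattice {τ : ℂ} (hτ : 0 < τ.im) : IsClosed (lattice τ) := by
  have hr : IsClosed (Set.range ((↑) : ℤ → ℝ)) := Int.isClosedEmbedding_coe_real.isClosed_range
  have : lattice τ = (fun z : ℂ ↦ z.im / τ.im) ⁻¹' Set.range ((↑) : ℤ → ℝ) ∩
      (fun z : ℂ ↦ z.re - z.im / τ.im * τ.re) ⁻¹' Set.range ((↑) : ℤ → ℝ) := by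
    ext z
    exact mem_lattice_iff hτ z
  rw [this]
  have h1 : Continuous fun z : ℂ ↦ z.im / τ.im := Complex.continuous_im.div_const _
  exact (hr.preimage h1).inter
    (hr.preimage (Complex.continuous_re.sub (h1.mul continuous_const)))

lemma eventually_notMem_lattice {τ : ℂ} (hτ : 0 < τ.im) {z : ℂ} (hz : z ∉ lattice τ) :
    ∀ᶠ w in 𝓝 z, w ∉ lattice τ :=
  (isClosed_lattice hτ).isOpen_compl.mem_nhds hz

lemma dense_compl_lattice (τ : ℂ) : Dense (lattice τ)ᶜ := by
  refine Set.Countable.dense_compl ℝ ?_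
  refine (Set.countable_range fun p : ℤ × ℤ ↦ (p.1 : ℂ) + p.2 * τ).mono ?_
  rintro z ⟨m, n, rfl⟩
  exact ⟨(m, n), rfl⟩

lemma eventually_nhdsNE_zero_notMem_lattice {τ : ℂ} (hτ : 0 < τ.im) :
    ∀ᶠ z in 𝓝[≠] (0 : ℂ), z ∉ lattice τ := by
  have h : Metric.ball (0 : ℂ) (min 1 τ.im) ∈ 𝓝 (0 : ℂ) :=
    Metric.ball_mem_nhds _ (lt_min one_pos hτ)
  filter_upwards [nhdsWithin_le_nhds h, self_mem_nhdsWithin] with z hz h0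
  rintro ⟨m, n, rfl⟩
  rw [mem_ball_zero_iff, lt_min_iff] at hz
  rcases eq_or_ne n 0 with rfl | hn
  · have h1 : ‖(m : ℂ)‖ < 1 := by simpa using hz.1
    rw [Complex.norm_intCast] at h1
    have h2 : |m| < 1 := by exact_mod_cast h1
    rw [Int.abs_lt_one_iff] at h2
    exact h0 (by simp [h2])
  · have h1 := (Complex.abs_im_le_norm _).trans_lt hz.2
    have h2 : |(n : ℝ)| * τ.im < τ.im := by
      simpa [abs_mul, abs_of_pos hτ] using h1
    have h3 : (1 : ℝ) ≤ |(n : ℝ)| := by exact_mod_cast Int.one_le_abs hn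
    nlinarith

lemma eventually_nhdsNE_notMem_lattice {τ : ℂ} (hτ : 0 < τ.im) (z : ℂ) :
    ∀ᶠ w in 𝓝[≠] z, w ∉ lattice τ := by
  by_cases hz : z ∈ lattice τ
  · obtain ⟨m, n, rfl⟩ := hz
    have ht : Tendsto (fun w : ℂ ↦ w - (m + n * τ)) (𝓝[≠] ((m : ℂ) + n * τ)) (𝓝[≠] 0) := by
      refine tendsto_nhdsWithin_iff.2 ⟨?_, ?_⟩
      · refine (Continuous.tendsto' (by fun_prop) _ _ (by simp)).mono_left nhdsWithin_le_nhds
      · filter_upwards [self_mem_nhdsWithin] with w hw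
        simpa [sub_eq_zero] using hw
    filter_upwards [ht.eventually (eventually_nhdsNE_zero_notMem_lattice hτ)] with w hw
    have := add_mem_lattice_iff (τ := τ) (z := w - (m + n * τ)) m n
    rw [sub_add_cancel] at this
    rwa [this]
  · exact nhdsWithin_le_nhds (eventually_notMem_lattice hτ hz)

/-! ### The theta function -/

lemma exp_pi_mul_I_mul_int (k : ℤ) : exp (π * I * k) = (-1) ^ k := by
  rw [show (π * I * k : ℂ) = k * (π * I) by ring, Complex.exp_int_mul, Complex.exp_pi_mul_I]

lemma exp_two_pi_mul_I_mul_int (k : ℤ) : exp (2 * π * I * k) = 1 := by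
  rw [show (2 * π * I * k : ℂ) = k * (2 * π * I) by ring, Complex.exp_int_mul_two_pi_mul_I]

lemma exp_pi_div_two_mul_I : exp (π * I / 2) = I := by
  rw [show (π * I / 2 : ℂ) = π / 2 * I by ring, Complex.exp_pi_div_two_mul_I]

/-- The numerators of the Appell–Lerch sum are the summands of a shifted Jacobi theta series. -/
lemma appell_numerator_eq (n : ℤ) (v τ : ℂ) :
    (-1 : ℂ) ^ n * exp (π * I * n * (n + 1) * τ + 2 * π * I * n * v) =
      jacobiTheta₂_term n (v + 1 / 2 + τ / 2) τ := by
  rw [jacobiTheta₂_term, ← exp_pi_mul_I_mul_int, ← Complex.exp_add]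
  ring_nf

lemma vartheta_eq (z τ : ℂ) :
    vartheta z τ = exp (π * I * τ / 4 + π * I * (z + 1 / 2)) *
      jacobiTheta₂ (z + 1 / 2 + τ / 2) τ := by
  rw [vartheta, jacobiTheta₂, ← tsum_mul_left]
  refine tsum_congr fun k ↦ ?_
  rw [jacobiTheta₂_term, ← Complex.exp_add]
  ring_nf

lemma differentiable_vartheta {τ : ℂ} (hτ : 0 < τ.im) :
    Differentiable ℂ fun z ↦ vartheta z τ := by
  intro z
  simp_rw [vartheta_eq]
  have h : DifferentiableAt ℂ (fun z ↦ jacobiTheta₂ (z + 1 / 2 + τ / 2) τ) z :=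
    (differentiableAt_jacobiTheta₂_fst (z + 1 / 2 + τ / 2) hτ).comp
      (f := fun z : ℂ ↦ z + 1 / 2 + τ / 2) z (by fun_prop)
  fun_prop

lemma vartheta_add_one (z τ : ℂ) : vartheta (z + 1) τ = -vartheta z τ := by
  rw [vartheta_eq, vartheta_eq, show z + 1 + 1 / 2 + τ / 2 = z + 1 / 2 + τ / 2 + 1 by ring,
    jacobiTheta₂_add_left, show π * I * τ / 4 + π * I * (z + 1 + 1 / 2) =
      π * I * τ / 4 + π * I * (z + 1 / 2) + π * I by ring, Complex.exp_add, Complex.exp_pi_mul_I]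
  ring

lemma vartheta_add_self (z τ : ℂ) :
    vartheta (z + τ) τ = -exp (-π * I * τ - 2 * π * I * z) * vartheta z τ := by
  rw [vartheta_eq, vartheta_eq, show z + τ + 1 / 2 + τ / 2 = z + 1 / 2 + τ / 2 + τ by ring,
    jacobiTheta₂_add_left', ← mul_assoc, ← mul_assoc, ← Complex.exp_add,
    ← neg_one_mul (exp _), ← Complex.exp_pi_mul_I, ← Complex.exp_add, ← Complex.exp_add]
  congr 1
  rw [Complex.exp_eq_exp_iff_exists_int]
  exact ⟨-1, by push_cast; ring⟩

lemma vartheta_neg (z τ : ℂ) : vartheta (-z) τ = -vartheta z τ := by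
  rw [vartheta_eq, vartheta_eq, ← jacobiTheta₂_neg_left,
    show -(-z + 1 / 2 + τ / 2) = z - 1 / 2 - τ / 2 by ring,
    show z + 1 / 2 + τ / 2 = z - 1 / 2 - τ / 2 + τ + 1 by ring, jacobiTheta₂_add_left,
    jacobiTheta₂_add_left', ← mul_assoc, ← Complex.exp_add, ← neg_mul,
    ← neg_one_mul (exp _), ← Complex.exp_pi_mul_I, ← Complex.exp_add]
  congr 1
  rw [Complex.exp_eq_exp_iff_exists_int]
  exact ⟨-1, by push_cast; ring⟩

lemma vartheta_zero (τ : ℂ) : vartheta 0 τ = 0 := by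
  have h := vartheta_neg 0 τ
  rw [neg_zero] at h
  exact self_eq_neg.mp h

lemma vartheta_add_one_right (z τ : ℂ) :
    vartheta z (τ + 1) = exp (π * I / 4) * vartheta z τ := by
  rw [vartheta, vartheta, ← tsum_mul_left]
  refine tsum_congr fun k ↦ ?_
  rw [← Complex.exp_add, Complex.exp_eq_exp_iff_exists_int]
  obtain ⟨j, hj⟩ := Int.even_mul_succ_self k
  refine ⟨j, ?_⟩
  have hj' : (k : ℂ) * (k + 1) = j + j := by exact_mod_cast hj
  linear_combination π * I * hj'

/-- The integral picks out the constant Fourier coefficient. It serves only to show that theta does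
not vanish identically. -/
lemma integral_jacobiTheta₂ {τ : ℂ} (hτ : 0 < τ.im) :
    ∫ x in (0 : ℝ)..1, jacobiTheta₂ x τ = 1 := by
  have hs : Summable fun n : ℤ ↦ ‖jacobiTheta₂_term n 0 τ‖ :=
    ((summable_jacobiTheta₂_term_iff 0 τ).2 hτ).norm
  let f : ℤ → C(ℝ, ℂ) := fun n ↦ ⟨fun x ↦ jacobiTheta₂_term n x τ, by
    unfold jacobiTheta₂_term; fun_prop⟩
  have hnorm (n : ℤ) (x : ℝ) : ‖f n x‖ = ‖jacobiTheta₂_term n 0 τ‖ := by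
    simp [f, norm_jacobiTheta₂_term]
  have hsum := intervalIntegral.hasSum_intervalIntegral_of_summable_norm (a := 0) (b := 1)
    (f := f) (by
    refine hs.of_nonneg_of_le (fun _ ↦ norm_nonneg _) fun n ↦ ?_
    exact (ContinuousMap.norm_le _ (norm_nonneg _)).2 fun x ↦ (hnorm n x).le)
  have hval (n : ℤ) : ∫ x in (0 : ℝ)..1, f n x = if n = 0 then 1 else 0 := by
    split_ifs with hn
    · simp [f, hn, jacobiTheta₂_term]
    · have h (x : ℝ) : f n x = exp (π * I * n ^ 2 * τ) * exp (2 * π * I * n * x) := by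
        simp only [f, ContinuousMap.coe_mk, jacobiTheta₂_term]
        rw [← Complex.exp_add]
        ring_nf
      have hc : (2 * π * I * n : ℂ) ≠ 0 := by simp [Real.pi_ne_zero, hn]
      simp_rw [h]
      rw [intervalIntegral.integral_const_mul, integral_exp_mul_complex hc]
      simp [exp_two_pi_mul_I_mul_int]
  simp_rw [hval] at hsum
  have h1 := hsum.unique (hasSum_ite_eq 0 1)
  rw [← h1]
  rfl

/-- By the identity theorem the alternative is ϑ = 0 everywhere, which contradicts the nonzero
Fourier coefficient. The exact location of the zeros is not yet known here. -/
lemma eventually_vartheta_ne_zero {τ : ℂ} (hτ : 0 < τ.im) (z : ℂ) :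
    ∀ᶠ w in 𝓝[≠] z, vartheta w τ ≠ 0 := by
  have han : AnalyticOnNhd ℂ (fun z ↦ vartheta z τ) Set.univ :=
    (differentiable_vartheta hτ).differentiableOn.analyticOnNhd isOpen_univ
  rcases (han z (Set.mem_univ _)).eventually_eq_zero_or_eventually_ne_zero with h | h
  · exfalso
    have h0 := han.eqOn_zero_of_preconnected_of_eventuallyEq_zero isPreconnected_univ
      (Set.mem_univ z) h
    have hJ (x : ℝ) : jacobiTheta₂ x τ = 0 := by
      have hx := h0 (Set.mem_univ ((x : ℂ) - 1 / 2 - τ / 2))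
      simp only [vartheta_eq, Pi.zero_apply, mul_eq_zero, Complex.exp_ne_zero, false_or] at hx
      rwa [show (x : ℂ) - 1 / 2 - τ / 2 + 1 / 2 + τ / 2 = x by ring] at hx
    have := integral_jacobiTheta₂ hτ
    simp [hJ] at this
  · exact h

/-! ### A Liouville theorem for sections of negative degree -/

/-- A function that is holomorphic off `ℤ + τℤ` with at most simple poles there and transforms like
a theta function of degree `-1` vanishes wherever `ϑ` does not. -/
theorem vartheta_mul_eq_zero {τ v : ℂ} (hτ : 0 < τ.im) (hv : v ∉ lattice τ) {f : ℂ → ℂ}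
    (hd : ∀ u ∉ lattice τ, DifferentiableAt ℂ f u)
    (h0 : (fun u ↦ u * f u) =O[𝓝[≠] 0] fun _ ↦ (1 : ℂ))
    (h1 : ∀ u ∉ lattice τ, f (u + 1) = -f u)
    (hs : ∀ u ∉ lattice τ, f (u + τ) = -exp (π * I * τ + 2 * π * I * (u - v)) * f u)
    {u : ℂ} (hu : u ∉ lattice τ) : vartheta u τ * f u = 0 := by
  -- Real coordinates v = pτ + q. The twist by exp(2πipu) in `g` turns the multipliers of ϑ·f into
  -- the constants exp(2πip) and exp(-2πiq), both of modulus 1.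
  set p : ℝ := v.im / τ.im with hp
  set q : ℝ := v.re - p * τ.re with hq
  have hvpq : v = p * τ + q := by
    apply Complex.ext
    · simp [hq]
    · simp [hp, hτ.ne']
  let g : ℂ → ℂ := fun u ↦ exp (2 * π * I * p * u) * (vartheta u τ * f u)
  have hg1 {u : ℂ} (hu : u ∉ lattice τ) : g (u + 1) = exp (2 * π * I * p) * g u := by
    simp only [g]
    rw [h1 u hu, vartheta_add_one, mul_add, mul_one, Complex.exp_add]
    ring
  have hgτ {u : ℂ} (hu : u ∉ lattice τ) : g (u + τ) = exp (-2 * π * I * q) * g u := by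
    simp only [g]
    rw [hs u hu, vartheta_add_self]
    have : exp (2 * π * I * p * (u + τ)) * exp (-π * I * τ - 2 * π * I * u) *
        exp (π * I * τ + 2 * π * I * (u - v)) =
        exp (-2 * π * I * q) * exp (2 * π * I * p * u) := by
      rw [← Complex.exp_add, ← Complex.exp_add, ← Complex.exp_add, hvpq]
      ring_nf
    linear_combination (vartheta u τ * f u) * this
  have hgd {u : ℂ} (hu : u ∉ lattice τ) : DifferentiableAt ℂ g u := by
    have h2 := hd u hu
    have h3 := differentiable_vartheta hτ u
    simp only [g]
    fun_prop
  classical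
  -- The junk value 0 at lattice points makes `F` periodic without exception, so bounds near 0
  -- transport to every lattice point.
  let F : ℂ → ℝ := fun u ↦ if u ∈ lattice τ then 0 else ‖g u‖
  have hFg {u : ℂ} (hu : u ∉ lattice τ) : F u = ‖g u‖ := if_neg hu
  have hn (x : ℝ) : ‖exp (2 * π * I * x)‖ = 1 := by
    rw [show (2 * π * I * x : ℂ) = (2 * π * x : ℝ) * I by push_cast; ring,
      Complex.norm_exp_ofReal_mul_I]
  have hF1 : Function.Periodic F 1 := by
    intro w
    by_cases hw : w ∈ lattice τ
    · simp only [F, if_pos hw, if_pos (add_one_mem_lattice_iff.2 hw)]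
    · rw [hFg hw, hFg (mt add_one_mem_lattice_iff.1 hw), hg1 hw, norm_mul, hn, one_mul]
  have hFτ : Function.Periodic F τ := by
    intro w
    by_cases hw : w ∈ lattice τ
    · simp only [F, if_pos hw, if_pos (add_self_mem_lattice_iff.2 hw)]
    · rw [hFg hw, hFg (mt add_self_mem_lattice_iff.1 hw), hgτ hw, norm_mul,
        show (-2 * π * I * q : ℂ) = 2 * π * I * (-q : ℝ) by push_cast; ring, hn, one_mul]
  have hF (m n : ℤ) : Function.Periodic F (m + n * τ) := by
    have := (hF1.int_mul m).add_period (hFτ.int_mul n)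
    rwa [mul_one] at this
  have hbdd0 : ∃ C, ∀ᶠ w in 𝓝[≠] (0 : ℂ), F w ≤ C := by
    -- The zero of ϑ at 0 compensates the simple pole of `f`.
    have hθ : (fun w ↦ vartheta w τ) =O[𝓝[≠] 0] fun w : ℂ ↦ w := by
      have := (differentiable_vartheta hτ 0).isBigO_sub
      simp only [vartheta_zero, sub_zero] at this
      exact this.mono nhdsWithin_le_nhds
    have he : (fun w : ℂ ↦ exp (2 * π * I * p * w)) =O[𝓝[≠] 0] fun _ ↦ (1 : ℂ) := by
      have : ContinuousAt (fun w : ℂ ↦ exp (2 * π * I * p * w)) 0 := by fun_prop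
      exact (this.tendsto.isBigO_one ℂ).mono nhdsWithin_le_nhds
    have hg0 : g =O[𝓝[≠] 0] fun _ ↦ (1 : ℂ) := by
      have h2 : (fun w ↦ vartheta w τ * f w) =O[𝓝[≠] 0] fun w ↦ w * f w :=
        hθ.mul (Asymptotics.isBigO_refl f _)
      simpa [g] using he.mul (h2.trans h0)
    obtain ⟨C, hC⟩ := hg0.bound
    refine ⟨C, ?_⟩
    filter_upwards [hC, eventually_nhdsNE_zero_notMem_lattice hτ] with w hw hw'
    rw [hFg hw']
    simpa using hw
  have hbdd (c : ℂ) : ∃ C, ∀ᶠ w in 𝓝[≠] c, F w ≤ C := by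
    by_cases hc : c ∈ lattice τ
    · obtain ⟨m, n, rfl⟩ := hc
      obtain ⟨C, hC⟩ := hbdd0
      refine ⟨C, ?_⟩
      have ht : Tendsto (fun w : ℂ ↦ w - (m + n * τ)) (𝓝[≠] ((m : ℂ) + n * τ)) (𝓝[≠] 0) := by
        refine tendsto_nhdsWithin_iff.2 ⟨?_, ?_⟩
        · exact (Continuous.tendsto' (by fun_prop) _ _ (by simp)).mono_left nhdsWithin_le_nhds
        · filter_upwards [self_mem_nhdsWithin] with w hw
          simpa [sub_eq_zero] using hw
      filter_upwards [ht.eventually hC] with w hw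
      rwa [(hF m n).sub_eq] at hw
    · refine ⟨‖g c‖ + 1, nhdsWithin_le_nhds ?_⟩
      have := (hgd hc).continuousAt.norm.eventually (gt_mem_nhds (lt_add_one ‖g c‖))
      filter_upwards [this, eventually_notMem_lattice hτ hc] with w hw hw'
      rw [hFg hw']
      exact hw.le
  -- `G` is the entire extension of `g` across its removable singularities.
  let G : ℂ → ℂ := fun c ↦ limUnder (𝓝[≠] c) g
  have hGg {u : ℂ} (hu : u ∉ lattice τ) : G u = g u :=
    ((hgd hu).continuousAt.tendsto.mono_left nhdsWithin_le_nhds).limUnder_eq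
  have hGd : Differentiable ℂ G := by
    intro c
    obtain ⟨C, hC⟩ := hbdd c
    have hev := hC.and (eventually_nhdsNE_notMem_lattice hτ c)
    rw [eventually_nhdsWithin_iff, Metric.eventually_nhds_iff_ball] at hev
    obtain ⟨ε, hε, hball⟩ := hev
    have hnhds := Metric.ball_mem_nhds c hε
    have hup := Complex.differentiableOn_update_limUnder_of_bddAbove (f := g) hnhds
      (fun w hw ↦ (hgd (hball w hw.1 hw.2).2).differentiableWithinAt) (by
        refine ⟨C, ?_⟩
        rintro _ ⟨w, hw, rfl⟩
        have h2 := hball w hw.1 hw.2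
        rw [hFg h2.2] at h2
        exact h2.1)
    refine (hup.differentiableAt hnhds).congr_of_eventuallyEq ?_
    filter_upwards [hnhds] with w hw
    by_cases hwc : w = c
    · subst hwc
      simp [G]
    · rw [Function.update_of_ne hwc, hGg (hball w hw hwc).2]
  -- A bound on the closed period parallelogram spreads by periodicity to all points off the
  -- lattice, and then by density to the whole plane.
  have hK : IsCompact ((fun x : ℝ × ℝ ↦ (x.1 + x.2 * τ : ℂ)) '' (Set.Icc 0 1 ×ˢ Set.Icc 0 1)) :=
    (isCompact_Icc.prod isCompact_Icc).image (by fun_prop)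
  obtain ⟨C, hC⟩ := hK.exists_bound_of_continuousOn hGd.continuous.continuousOn
  have hGC (u : ℂ) (hu : u ∉ lattice τ) : ‖G u‖ ≤ C := by
    set y : ℝ := u.im / τ.im with hy
    set x : ℝ := u.re - y * τ.re with hx
    have huxy : u = x + y * τ := by
      apply Complex.ext
      · simp [hx]
      · simp [hy, hτ.ne']
    set w : ℂ := (Int.fract x : ℝ) + (Int.fract y : ℝ) * τ with hw
    have huw : u = w + (⌊x⌋ + ⌊y⌋ * τ) := by
      rw [huxy, hw, Int.fract, Int.fract]
      push_cast
      ring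
    have hw' : w ∉ lattice τ := by rwa [huw, add_mem_lattice_iff] at hu
    have h2 : F u = F w := by rw [huw]; exact hF _ _ w
    rw [hGg hu, ← hFg hu, h2, hFg hw', ← hGg hw']
    exact hC w ⟨(Int.fract x, Int.fract y), ⟨⟨Int.fract_nonneg _, (Int.fract_lt_one _).le⟩,
      ⟨Int.fract_nonneg _, (Int.fract_lt_one _).le⟩⟩, rfl⟩
  have hGC' (u : ℂ) : ‖G u‖ ≤ C := by
    have hcl : IsClosed {u | ‖G u‖ ≤ C} := isClosed_le hGd.continuous.norm continuous_const
    exact hcl.closure_subset_iff.2 (fun u hu ↦ hGC u hu) (dense_compl_lattice τ u)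
  have hconst : ∀ z w, G z = G w := hGd.apply_eq_apply_of_bounded
    (isBounded_iff_forall_norm_le.2 ⟨C, by rintro _ ⟨u, rfl⟩; exact hGC' u⟩)
  have e1 := hg1 hu
  have e2 := hgτ hu
  rw [← hGg (mt add_one_mem_lattice_iff.1 hu), hconst _ u, hGg hu] at e1
  rw [← hGg (mt add_self_mem_lattice_iff.1 hu), hconst _ u, hGg hu] at e2
  -- Liouville makes `G` constant, so a nonzero value would force both multipliers to be 1, that is
  -- p and q integral and v in the lattice.
  by_cases hgu : g u = 0
  · simpa [g, Complex.exp_ne_zero] using hgu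
  · exfalso
    have h_int (x : ℝ) (h : exp (2 * π * I * x) = 1) : x ∈ Set.range ((↑) : ℤ → ℝ) := by
      obtain ⟨n, hn⟩ := Complex.exp_eq_one_iff.1 h
      refine ⟨n, ?_⟩
      have h2 : (2 * π * I : ℂ) ≠ 0 := by simp [Real.pi_ne_zero]
      have : (x : ℂ) = n := mul_left_cancel₀ h2 (by rw [hn]; ring)
      exact_mod_cast this.symm
    refine hv ((mem_lattice_iff hτ v).2 ⟨h_int p ?_, h_int q ?_⟩)
    · exact mul_right_cancel₀ hgu (by rw [← e1, one_mul])
    · have h3 : exp (-2 * π * I * q) = 1 := mul_right_cancel₀ hgu (by rw [← e2, one_mul])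
      rw [show (-2 * π * I * q : ℂ) = -(2 * π * I * q) by ring, Complex.exp_neg,
        inv_eq_one] at h3
      exact h3

/-! ### The Appell–Lerch sum -/

lemma norm_appell_exp (n : ℤ) (u τ : ℂ) :
    ‖exp (2 * π * I * n * τ + 2 * π * I * u)‖ = Real.exp (-(2 * π) * (n * τ.im + u.im)) := by
  rw [Complex.norm_exp]
  congr 1
  simp
  ring

/-- Once |n Im τ + Im u| ≥ 1, the exponential has modulus at least e^{2π} ≥ 3 or at most 1/3. So
only finitely many denominators can be small, uniformly on a horizontal strip. -/
lemma exists_finset_le_norm_one_sub {τ : ℂ} (hτ : 0 < τ.im) (S : ℝ) :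
    ∃ F : Finset ℤ, ∀ n ∉ F, ∀ u : ℂ, |u.im| < S →
      1 / 2 ≤ ‖1 - exp (2 * π * I * n * τ + 2 * π * I * u)‖ := by
  obtain ⟨M, hM⟩ := exists_nat_ge ((S + 1) / τ.im)
  rw [div_le_iff₀ hτ] at hM
  refine ⟨Finset.Icc (-M) M, fun n hn u hu ↦ ?_⟩
  rw [abs_lt] at hu
  have h3 : 3 ≤ Real.exp (2 * π) := by
    have := Real.add_one_le_exp (2 * π)
    linarith [Real.pi_gt_three]
  have hpi := Real.pi_pos
  rw [Finset.mem_Icc, not_and_or, not_le, not_le] at hn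
  rcases hn with hn | hn
  · have hn' : (n : ℝ) ≤ -M := by exact_mod_cast hn.le
    have h1 : 1 ≤ -(n * τ.im + u.im) := by nlinarith
    have h2 : Real.exp (2 * π) ≤ ‖exp (2 * π * I * n * τ + 2 * π * I * u)‖ := by
      rw [norm_appell_exp]
      exact Real.exp_le_exp.2 (by nlinarith)
    have h4 := norm_sub_norm_le (exp (2 * π * I * n * τ + 2 * π * I * u)) 1
    rw [norm_one, norm_sub_rev] at h4
    linarith
  · have hn' : (M : ℝ) ≤ n := by exact_mod_cast hn.le
    have h1 : 1 ≤ n * τ.im + u.im := by nlinarith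
    have h2 : ‖exp (2 * π * I * n * τ + 2 * π * I * u)‖ ≤ Real.exp (-(2 * π)) := by
      rw [norm_appell_exp]
      exact Real.exp_le_exp.2 (by nlinarith)
    have h5 : Real.exp (-(2 * π)) ≤ 3⁻¹ := by
      rw [Real.exp_neg]
      exact inv_anti₀ (by norm_num) h3
    have h4 := norm_sub_norm_le 1 (exp (2 * π * I * n * τ + 2 * π * I * u))
    rw [norm_one] at h4
    linarith

/-- Continuity handles the finitely many exceptional indices. Denominators vanishing at `u` are
excluded so that the bound still applies at a lattice point after the polar term is removed. -/
lemma eventually_le_norm_one_sub {τ u : ℂ} (hτ : 0 < τ.im) :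
    ∃ δ > 0, ∀ᶠ w in 𝓝 u, ∀ n : ℤ, 1 - exp (2 * π * I * n * τ + 2 * π * I * u) ≠ 0 →
      δ ≤ ‖1 - exp (2 * π * I * n * τ + 2 * π * I * w)‖ := by
  obtain ⟨F, hF⟩ := exists_finset_le_norm_one_sub hτ (|u.im| + 1)
  have key (F : Finset ℤ) : ∃ δ > 0, ∀ᶠ w in 𝓝 u, ∀ n ∈ F,
      1 - exp (2 * π * I * n * τ + 2 * π * I * u) ≠ 0 →
      δ ≤ ‖1 - exp (2 * π * I * n * τ + 2 * π * I * w)‖ := by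
    induction F using Finset.induction_on with
    | empty => exact ⟨1, one_pos, by simp⟩
    | insert m F hm ih =>
      obtain ⟨δ, hδ, h⟩ := ih
      by_cases h0 : 1 - exp (2 * π * I * m * τ + 2 * π * I * u) = 0
      · refine ⟨δ, hδ, h.mono fun w hw n hn hne ↦ ?_⟩
        rcases Finset.mem_insert.1 hn with rfl | hn
        · exact absurd h0 hne
        · exact hw n hn hne
      · have hc : ContinuousAt (fun w ↦ ‖1 - exp (2 * π * I * m * τ + 2 * π * I * w)‖) u := by
          fun_prop
        have hpos := norm_pos_iff.2 h0
        refine ⟨min δ (‖1 - exp (2 * π * I * m * τ + 2 * π * I * u)‖ / 2),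
          lt_min hδ (half_pos hpos), ?_⟩
        filter_upwards [h, hc.eventually (lt_mem_nhds (half_lt_self hpos))] with w hw hw' n hn hne
        rcases Finset.mem_insert.1 hn with rfl | hn
        · exact (min_le_right _ _).trans hw'.le
        · exact (min_le_left _ _).trans (hw n hn hne)
  obtain ⟨δ, hδ, h⟩ := key F
  have him : ∀ᶠ w : ℂ in 𝓝 u, |w.im| < |u.im| + 1 :=
    (Complex.continuous_im.abs.continuousAt (x := u)).eventually (gt_mem_nhds (lt_add_one |u.im|))
  refine ⟨min δ (1 / 2), lt_min hδ (by norm_num), ?_⟩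
  filter_upwards [h, him] with w hw hw' n hne
  by_cases hn : n ∈ F
  · exact (min_le_left _ _).trans (hw n hn hne)
  · exact (min_le_right _ _).trans (hF n hn w hw')

/-- Locally uniform convergence by the Weierstrass test. A zero coefficient is allowed to sit over a
vanishing denominator, which is what the regular part at u = 0 needs. -/
lemma differentiableAt_tsum_div_one_sub {τ u : ℂ} (hτ : 0 < τ.im) {a : ℤ → ℂ}
    (ha : Summable fun n ↦ ‖a n‖)
    (h : ∀ n : ℤ, 1 - exp (2 * π * I * n * τ + 2 * π * I * u) = 0 → a n = 0) :
    DifferentiableAt ℂ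
      (fun w ↦ ∑' n : ℤ, a n / (1 - exp (2 * π * I * n * τ + 2 * π * I * w))) u := by
  obtain ⟨δ, hδ, hev⟩ := eventually_le_norm_one_sub (u := u) hτ
  obtain ⟨ε, hε, hball⟩ := Metric.eventually_nhds_iff_ball.1 hev
  have hnhds := Metric.ball_mem_nhds u hε
  refine (DifferentiableOn.differentiableAt ?_ hnhds)
  refine Complex.differentiableOn_tsum_of_summable_norm (ha.div_const δ) (fun n w hw ↦ ?_)
    Metric.isOpen_ball (fun n w hw ↦ ?_)
  · by_cases hn : 1 - exp (2 * π * I * n * τ + 2 * π * I * u) = 0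
    · simp only [h n hn, zero_div]
      exact differentiableWithinAt_const 0
    · have h1 := hball w hw n hn
      have h2 : 1 - exp (2 * π * I * n * τ + 2 * π * I * w) ≠ 0 :=
        norm_pos_iff.1 (hδ.trans_le h1)
      refine DifferentiableAt.differentiableWithinAt ?_
      fun_prop (disch := assumption)
  · by_cases hn : 1 - exp (2 * π * I * n * τ + 2 * π * I * u) = 0
    · simp [h n hn]
    · rw [norm_div]
      exact div_le_div_of_nonneg_left (norm_nonneg _) hδ (hball w hw n hn)

lemma summable_div_one_sub {τ u : ℂ} (hτ : 0 < τ.im) {a : ℤ → ℂ} (ha : Summable fun n ↦ ‖a n‖)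
    (h : ∀ n : ℤ, 1 - exp (2 * π * I * n * τ + 2 * π * I * u) ≠ 0) :
    Summable fun n : ℤ ↦ a n / (1 - exp (2 * π * I * n * τ + 2 * π * I * u)) := by
  obtain ⟨δ, hδ, hev⟩ := eventually_le_norm_one_sub (u := u) hτ
  refine (ha.div_const δ).of_norm_bounded fun n ↦ ?_
  rw [norm_div]
  exact div_le_div_of_nonneg_left (norm_nonneg _) hδ (hev.self_of_nhds n (h n))

lemma one_sub_exp_ne_zero {τ u : ℂ} (hu : u ∉ lattice τ) (n : ℤ) :
    1 - exp (2 * π * I * n * τ + 2 * π * I * u) ≠ 0 := by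
  intro h
  obtain ⟨m, hm⟩ := Complex.exp_eq_one_iff.1 (sub_eq_zero.1 h).symm
  have h2 : (2 * π * I : ℂ) ≠ 0 := by simp [Real.pi_ne_zero]
  refine hu ⟨m, -n, mul_left_cancel₀ h2 ?_⟩
  push_cast
  linear_combination hm

/-- The sum in the definition of `μ(u,v;τ)`. -/
def appellSum (u v τ : ℂ) : ℂ :=
  ∑' n : ℤ, jacobiTheta₂_term n (v + 1 / 2 + τ / 2) τ
    / (1 - exp (2 * π * I * n * τ + 2 * π * I * u))

lemma mu_eq (u v τ : ℂ) : mu u v τ = exp (π * I * u) / vartheta v τ * appellSum u v τ := by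
  simp only [mu, appellSum, appell_numerator_eq]

lemma summable_norm_jacobiTheta₂_term {τ : ℂ} (hτ : 0 < τ.im) (z : ℂ) :
    Summable fun n ↦ ‖jacobiTheta₂_term n z τ‖ :=
  ((summable_jacobiTheta₂_term_iff z τ).2 hτ).norm

lemma summable_appellSum {τ u : ℂ} (hτ : 0 < τ.im) (hu : u ∉ lattice τ) (v : ℂ) :
    Summable fun n : ℤ ↦ jacobiTheta₂_term n (v + 1 / 2 + τ / 2) τ
      / (1 - exp (2 * π * I * n * τ + 2 * π * I * u)) :=
  summable_div_one_sub hτ (summable_norm_jacobiTheta₂_term hτ _) (one_sub_exp_ne_zero hu)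

lemma differentiableAt_appellSum {τ u : ℂ} (hτ : 0 < τ.im) (hu : u ∉ lattice τ) (v : ℂ) :
    DifferentiableAt ℂ (fun w ↦ appellSum w v τ) u :=
  differentiableAt_tsum_div_one_sub hτ (summable_norm_jacobiTheta₂_term hτ _)
    fun n hn ↦ absurd hn (one_sub_exp_ne_zero hu n)

/-- The polar part of the Appell–Lerch sum at `u = 0`. -/
lemma exists_appellSum_eq_polar_add {τ : ℂ} (hτ : 0 < τ.im) (v : ℂ) :
    ∃ g : ℂ → ℂ, ContinuousAt g 0 ∧
      ∀ u ∉ lattice τ, appellSum u v τ = 1 / (1 - exp (2 * π * I * u)) + g u := by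
  let a : ℤ → ℂ := fun n ↦ if n = 0 then 0 else jacobiTheta₂_term n (v + 1 / 2 + τ / 2) τ
  have ha : Summable fun n ↦ ‖a n‖ := by
    refine (summable_norm_jacobiTheta₂_term hτ (v + 1 / 2 + τ / 2)).of_nonneg_of_le
      (fun _ ↦ norm_nonneg _) fun n ↦ ?_
    simp only [a]
    split_ifs <;> simp
  refine ⟨fun w ↦ ∑' n : ℤ, a n / (1 - exp (2 * π * I * n * τ + 2 * π * I * w)),
    (differentiableAt_tsum_div_one_sub hτ ha fun n hn ↦ ?_).continuousAt, fun u hu ↦ ?_⟩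
  · by_contra hn0
    have hn' : n ≠ 0 := by
      rintro rfl
      simp [a] at hn0
    obtain ⟨m, hm⟩ := Complex.exp_eq_one_iff.1 (sub_eq_zero.1 hn).symm
    have h2 : (2 * π * I : ℂ) ≠ 0 := by simp [Real.pi_ne_zero]
    have h3 : (n : ℂ) * τ = m := mul_left_cancel₀ h2 (by linear_combination hm)
    have h4 := congrArg Complex.im h3
    simp [hτ.ne', hn'] at h4
  · rw [appellSum, (summable_appellSum hτ hu v).tsum_eq_add_tsum_ite 0]
    congr 1
    · simp [jacobiTheta₂_term]
    · refine tsum_congr fun n ↦ ?_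
      simp only [a]
      split_ifs <;> simp

lemma hasDerivAt_one_sub_exp_zero :
    HasDerivAt (fun u : ℂ ↦ 1 - exp (2 * π * I * u)) (-(2 * π * I)) 0 := by
  have h := (((hasDerivAt_id (0 : ℂ)).const_mul (2 * π * I)).cexp).const_sub 1
  simpa using h

/-- Only the term n = 0 is singular. The nonzero residue is what later contradicts vanishing of the
sum. -/
lemma tendsto_mul_appellSum {τ : ℂ} (hτ : 0 < τ.im) (v : ℂ) :
    Tendsto (fun u ↦ u * appellSum u v τ) (𝓝[≠] 0) (𝓝 (-(2 * π * I))⁻¹) := by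
  obtain ⟨g, hg, h⟩ := exists_appellSum_eq_polar_add hτ v
  have h1 : Tendsto (fun u : ℂ ↦ u / (1 - exp (2 * π * I * u))) (𝓝[≠] 0)
      (𝓝 (-(2 * π * I))⁻¹) := by
    have h2 := (hasDerivAt_iff_tendsto_slope_zero.1 hasDerivAt_one_sub_exp_zero).inv₀
      (by simp [Real.pi_ne_zero])
    refine h2.congr fun u ↦ ?_
    simp [div_eq_mul_inv, mul_comm]
  have h3 : Tendsto (fun u : ℂ ↦ u * g u) (𝓝[≠] 0) (𝓝 0) := by
    have := (tendsto_id (α := ℂ) (x := 𝓝 0)).mul hg.tendsto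
    rw [zero_mul] at this
    exact this.mono_left nhdsWithin_le_nhds
  have h4 := h1.add h3
  rw [add_zero] at h4
  refine h4.congr' ?_
  filter_upwards [eventually_nhdsNE_zero_notMem_lattice hτ] with u hu
  rw [h u hu]
  ring

lemma appellSum_add_one (u v τ : ℂ) : appellSum (u + 1) v τ = appellSum u v τ := by
  refine tsum_congr fun n ↦ ?_
  rw [show 2 * π * I * n * τ + 2 * π * I * (u + 1) =
    2 * π * I * n * τ + 2 * π * I * u + 2 * π * I by ring, Complex.exp_add,
    Complex.exp_two_pi_mul_I, mul_one]

lemma jacobiTheta₂_eq_vartheta (v τ : ℂ) :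
    jacobiTheta₂ (v + 1 / 2 + τ / 2) τ =
      exp (-(π * I * τ / 4 + π * I * (v + 1 / 2))) * vartheta v τ := by
  rw [vartheta_eq, ← mul_assoc, ← Complex.exp_add, neg_add_cancel, Complex.exp_zero, one_mul]

/-- After an index shift, the numerators satisfy e^{2πi(u-v)} a_{n+1} = -x a_n with x the
exponential in the denominator. Then 1/(1-x) = 1 + x/(1-x) splits off a complete theta series. -/
lemma appellSum_add_self {τ u : ℂ} (hτ : 0 < τ.im) (hu : u ∉ lattice τ) (v : ℂ) :
    appellSum (u + τ) v τ = jacobiTheta₂ (v + 1 / 2 + τ / 2) τ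
      - exp (2 * π * I * (u - v)) * appellSum u v τ := by
  have hs := summable_appellSum hτ hu v
  have hs1 : Summable fun n : ℤ ↦ jacobiTheta₂_term (Equiv.addRight 1 n) (v + 1 / 2 + τ / 2) τ
      / (1 - exp (2 * π * I * (Equiv.addRight 1 n : ℤ) * τ + 2 * π * I * u)) :=
    (Equiv.addRight (1 : ℤ)).summable_iff.2 hs
  have h1 : appellSum u v τ = _ := ((Equiv.addRight (1 : ℤ)).tsum_eq _).symm
  rw [h1, ← tsum_mul_left, jacobiTheta₂,
    ← Summable.tsum_sub ((summable_jacobiTheta₂_term_iff _ τ).2 hτ)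
      (Summable.mul_left (exp (2 * π * I * (u - v))) hs1)]
  refine tsum_congr fun n ↦ ?_
  have hx := one_sub_exp_ne_zero hu (n + 1)
  simp only [Equiv.coe_addRight]
  have hx' : 2 * π * I * n * τ + 2 * π * I * (u + τ) =
      2 * π * I * ((n + 1 : ℤ) : ℂ) * τ + 2 * π * I * u := by push_cast; ring
  rw [hx']
  have h2 : exp (2 * π * I * (u - v)) * jacobiTheta₂_term (n + 1) (v + 1 / 2 + τ / 2) τ =
      -(exp (2 * π * I * ((n + 1 : ℤ) : ℂ) * τ + 2 * π * I * u) *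
        jacobiTheta₂_term n (v + 1 / 2 + τ / 2) τ) := by
    rw [jacobiTheta₂_term, jacobiTheta₂_term, ← Complex.exp_add, ← Complex.exp_add,
      ← neg_one_mul, ← Complex.exp_pi_mul_I, ← Complex.exp_add]
    push_cast
    ring_nf
  rw [← mul_div_assoc, h2]
  generalize exp (2 * π * I * ((n + 1 : ℤ) : ℂ) * τ + 2 * π * I * u) = x at *
  field_simp
  ring

lemma appellSum_add_one_right (u v τ : ℂ) : appellSum u (v + 1) τ = appellSum u v τ := by
  refine tsum_congr fun n ↦ ?_
  congr 1
  rw [jacobiTheta₂_term, jacobiTheta₂_term, Complex.exp_eq_exp_iff_exists_int]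
  exact ⟨n, by ring⟩

/-- Here no index shift is needed: the numerator gains e^{-2πiu} x, and x/(1-x) = 1/(1-x) - 1. -/
lemma appellSum_add_self_right {τ u : ℂ} (hτ : 0 < τ.im) (hu : u ∉ lattice τ) (v : ℂ) :
    appellSum u (v + τ) τ = exp (-2 * π * I * u) *
      (appellSum u v τ - jacobiTheta₂ (v + 1 / 2 + τ / 2) τ) := by
  rw [appellSum, appellSum, jacobiTheta₂, ← Summable.tsum_sub (summable_appellSum hτ hu v)
    ((summable_jacobiTheta₂_term_iff _ τ).2 hτ), ← tsum_mul_left]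
  refine tsum_congr fun n ↦ ?_
  have hx := one_sub_exp_ne_zero hu n
  have h2 : jacobiTheta₂_term n (v + τ + 1 / 2 + τ / 2) τ =
      exp (-2 * π * I * u) * (exp (2 * π * I * n * τ + 2 * π * I * u) *
        jacobiTheta₂_term n (v + 1 / 2 + τ / 2) τ) := by
    rw [jacobiTheta₂_term, jacobiTheta₂_term, ← Complex.exp_add, ← Complex.exp_add]
    ring_nf
  rw [h2]
  generalize exp (2 * π * I * n * τ + 2 * π * I * u) = x at *
  field_simp
  ring

lemma appellSum_add_one_modulus (u v τ : ℂ) : appellSum u v (τ + 1) = appellSum u v τ := by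
  refine tsum_congr fun n ↦ ?_
  congr 1
  · rw [jacobiTheta₂_term, jacobiTheta₂_term, Complex.exp_eq_exp_iff_exists_int]
    obtain ⟨j, hj⟩ := Int.even_mul_succ_self n
    refine ⟨j, ?_⟩
    have hj' : (n : ℂ) * (n + 1) = j + j := by exact_mod_cast hj
    linear_combination π * I * hj'
  · congr 1
    rw [Complex.exp_eq_exp_iff_exists_int]
    exact ⟨n, by ring⟩

/-- If ϑ(v) = 0, the theta term in `appellSum_add_self` drops out and e^{πiu} times the Appell–Lerch
sum satisfies the hypotheses of `vartheta_mul_eq_zero`. It would then vanish wherever ϑ(u) ≠ 0,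
against its nonzero residue at u = 0. -/
theorem vartheta_ne_zero {τ v : ℂ} (hτ : 0 < τ.im) (hv : v ∉ lattice τ) : vartheta v τ ≠ 0 := by
  intro hv0
  have hJ : jacobiTheta₂ (v + 1 / 2 + τ / 2) τ = 0 := by
    rw [jacobiTheta₂_eq_vartheta, hv0, mul_zero]
  have ht : Tendsto (fun u ↦ u * (exp (π * I * u) * appellSum u v τ)) (𝓝[≠] 0)
      (𝓝 (-(2 * π * I))⁻¹) := by
    have he : Tendsto (fun u : ℂ ↦ exp (π * I * u)) (𝓝[≠] 0) (𝓝 1) := by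
      refine (Continuous.tendsto' (by fun_prop) _ _ (by simp)).mono_left nhdsWithin_le_nhds
    have := he.mul (tendsto_mul_appellSum hτ v)
    rw [one_mul] at this
    exact this.congr fun u ↦ by ring
  have hz {u : ℂ} (hu : u ∉ lattice τ) :=
    vartheta_mul_eq_zero hτ hv (f := fun u ↦ exp (π * I * u) * appellSum u v τ)
      (fun u hu ↦ by
        have := differentiableAt_appellSum hτ hu v
        fun_prop)
      (ht.isBigO_one ℂ)
      (fun u hu ↦ by
        rw [appellSum_add_one, mul_add, mul_one, Complex.exp_add, Complex.exp_pi_mul_I]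
        ring)
      (fun u hu ↦ by
        rw [appellSum_add_self hτ hu, hJ, mul_add, Complex.exp_add, Complex.exp_add]
        ring) hu
  have hne : ∀ᶠ u in 𝓝[≠] (0 : ℂ), u * (exp (π * I * u) * appellSum u v τ) ≠ 0 :=
    ht.eventually_ne (by simp [Real.pi_ne_zero])
  obtain ⟨u, hu1, hu2, hu3⟩ := ((eventually_vartheta_ne_zero hτ 0).and
    (hne.and (eventually_nhdsNE_zero_notMem_lattice hτ))).exists
  exact hu2 (by rw [(mul_eq_zero.1 (hz hu3)).resolve_left hu1, mul_zero])

/-! ### Elliptic transformations of `μ` -/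

lemma neg_I_mul_exp (x : ℂ) : -I * exp x = exp (x - π * I / 2) := by
  rw [Complex.exp_sub, exp_pi_div_two_mul_I, Complex.div_I]
  ring

lemma mu_add_one (u v τ : ℂ) : mu (u + 1) v τ = -mu u v τ := by
  rw [mu_eq, mu_eq, appellSum_add_one, mul_add, mul_one, Complex.exp_add, Complex.exp_pi_mul_I]
  ring

lemma mu_add_self {τ u v : ℂ} (hτ : 0 < τ.im) (hu : u ∉ lattice τ) (hv : v ∉ lattice τ) :
    mu (u + τ) v τ = -exp (π * I * τ + 2 * π * I * (u - v)) * mu u v τ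
      - I * exp (π * I * (u - v) + 3 * π * I * τ / 4) := by
  have h := vartheta_ne_zero hτ hv
  have h1 : exp (π * I * (u + τ)) * exp (-(π * I * τ / 4 + π * I * (v + 1 / 2))) =
      -I * exp (π * I * (u - v) + 3 * π * I * τ / 4) := by
    rw [neg_I_mul_exp, ← Complex.exp_add]
    ring_nf
  have h2 : exp (π * I * (u + τ)) * exp (2 * π * I * (u - v)) =
      exp (π * I * τ + 2 * π * I * (u - v)) * exp (π * I * u) := by
    rw [← Complex.exp_add, ← Complex.exp_add]
    ring_nf
  rw [mu_eq, mu_eq, appellSum_add_self hτ hu, jacobiTheta₂_eq_vartheta]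
  generalize exp (-(π * I * τ / 4 + π * I * (v + 1 / 2))) = x₁ at *
  generalize exp (π * I * (u - v) + 3 * π * I * τ / 4) = x₂ at *
  generalize exp (2 * π * I * (u - v)) = x₃ at *
  generalize exp (π * I * τ + 2 * π * I * (u - v)) = x₄ at *
  field_simp
  linear_combination vartheta v τ * h1 - appellSum u v τ * h2

lemma mu_add_one_right (u v τ : ℂ) : mu u (v + 1) τ = -mu u v τ := by
  rw [mu_eq, mu_eq, appellSum_add_one_right, vartheta_add_one, div_neg]
  ring

lemma mu_add_self_right {τ u v : ℂ} (hτ : 0 < τ.im) (hu : u ∉ lattice τ) (hv : v ∉ lattice τ) :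
    mu u (v + τ) τ = -exp (π * I * τ - 2 * π * I * (u - v)) * mu u v τ
      - I * exp (-π * I * (u - v) + 3 * π * I * τ / 4) := by
  have h := vartheta_ne_zero hτ hv
  have h1 : exp (π * I * u) * exp (-2 * π * I * u) *
      exp (-(π * I * τ / 4 + π * I * (v + 1 / 2))) =
      -I * exp (-π * I * (u - v) + 3 * π * I * τ / 4) * exp (-π * I * τ - 2 * π * I * v) := by
    rw [neg_I_mul_exp, ← Complex.exp_add, ← Complex.exp_add, ← Complex.exp_add]
    ring_nf
  have h2 : exp (π * I * u) * exp (-2 * π * I * u) =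
      exp (π * I * τ - 2 * π * I * (u - v)) * exp (π * I * u) *
        exp (-π * I * τ - 2 * π * I * v) := by
    rw [← Complex.exp_add, ← Complex.exp_add, ← Complex.exp_add]
    ring_nf
  have h3 : exp (-π * I * τ - 2 * π * I * v) ≠ 0 := Complex.exp_ne_zero _
  rw [mu_eq, mu_eq, appellSum_add_self_right hτ hu, jacobiTheta₂_eq_vartheta, vartheta_add_self]
  generalize exp (-(π * I * τ / 4 + π * I * (v + 1 / 2))) = x₁ at *
  generalize exp (-π * I * (u - v) + 3 * π * I * τ / 4) = x₂ at *
  generalize exp (-2 * π * I * u) = x₃ at *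
  generalize exp (π * I * τ - 2 * π * I * (u - v)) = x₄ at *
  generalize exp (-π * I * τ - 2 * π * I * v) = x₅ at *
  field_simp
  linear_combination vartheta v τ * h1 - appellSum u v τ * h2

lemma mu_add_one_modulus (u v τ : ℂ) : mu u v (τ + 1) = exp (-π * I / 4) * mu u v τ := by
  rw [mu_eq, mu_eq, appellSum_add_one_modulus, vartheta_add_one_right,
    show (-π * I / 4 : ℂ) = -(π * I / 4) by ring, Complex.exp_neg]
  field_simp

lemma differentiableAt_mu {τ u : ℂ} (hτ : 0 < τ.im) (hu : u ∉ lattice τ) (v : ℂ) :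
    DifferentiableAt ℂ (fun w ↦ mu w v τ) u := by
  simp_rw [mu_eq]
  have := differentiableAt_appellSum hτ hu v
  fun_prop

lemma isBigO_mul_mu {τ : ℂ} (hτ : 0 < τ.im) (v : ℂ) :
    (fun u ↦ u * mu u v τ) =O[𝓝[≠] 0] fun _ ↦ (1 : ℂ) := by
  have he : (fun u : ℂ ↦ exp (π * I * u) / vartheta v τ) =O[𝓝[≠] 0] fun _ ↦ (1 : ℂ) := by
    have : ContinuousAt (fun u : ℂ ↦ exp (π * I * u) / vartheta v τ) 0 := by fun_prop
    exact (this.tendsto.isBigO_one ℂ).mono nhdsWithin_le_nhds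
  refine (he.mul ((tendsto_mul_appellSum hτ v).isBigO_one ℂ)).congr (fun u ↦ ?_) fun u ↦ by simp
  rw [mu_eq]
  ring

/-! ### The error function -/

lemma integrable_gaussian_pi : MeasureTheory.Integrable fun w : ℝ ↦ Real.exp (-π * w ^ 2) :=
  integrable_exp_neg_mul_sq Real.pi_pos

lemma hasDerivAt_E (x : ℝ) : HasDerivAt E (2 * Real.exp (-π * x ^ 2)) x := by
  have hc : Continuous fun w : ℝ ↦ Real.exp (-π * w ^ 2) := by fun_prop
  exact (intervalIntegral.integral_hasDerivAt_right (hc.intervalIntegrable _ _)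
    (hc.stronglyMeasurableAtFilter _ _) hc.continuousAt).const_mul 2

lemma E_neg (x : ℝ) : E (-x) = -E x := by
  have h := intervalIntegral.integral_comp_neg (a := 0) (b := x)
    fun w : ℝ ↦ Real.exp (-π * w ^ 2)
  simp only [even_two.neg_pow, neg_zero] at h
  rw [E, E, intervalIntegral.integral_symm, ← h]
  ring

lemma one_sub_E (x : ℝ) : 1 - E x = 2 * ∫ w in Set.Ioi x, Real.exp (-π * w ^ 2) := by
  have h := intervalIntegral.integral_interval_add_Ioi (a := 0) (b := x)
    integrable_gaussian_pi.integrableOn integrable_gaussian_pi.integrableOn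
  rw [integral_gaussian_Ioi, div_self Real.pi_ne_zero, Real.sqrt_one] at h
  rw [E]
  linear_combination (-2) * h

lemma one_sub_E_nonneg (x : ℝ) : 0 ≤ 1 - E x := by
  rw [one_sub_E]
  exact mul_nonneg zero_le_two (MeasureTheory.integral_nonneg fun _ ↦ (Real.exp_pos _).le)

lemma abs_E_le_one (x : ℝ) : |E x| ≤ 1 := by
  have h1 := one_sub_E_nonneg x
  have h2 := one_sub_E_nonneg (-x)
  rw [E_neg] at h2
  exact abs_le.2 ⟨by linarith, by linarith⟩

/-- Translate the tail integral to start at 0 and use (t + x)² ≥ t² + x² for t, x ≥ 0. -/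
lemma one_sub_E_le {x : ℝ} (hx : 0 ≤ x) : 1 - E x ≤ Real.exp (-π * x ^ 2) := by
  have h1 : ∫ w in Set.Ioi x, Real.exp (-π * w ^ 2) =
      ∫ t in Set.Ioi (0 : ℝ), Real.exp (-π * (t + x) ^ 2) := by
    have := (MeasureTheory.measurePreserving_add_right
      MeasureTheory.volume x).setIntegral_preimage_emb (measurableEmbedding_addRight x) (fun w ↦ Real.exp (-π * w ^ 2)) (Set.Ioi x)
    rw [← this, Set.preimage_add_const_Ioi, sub_self]
  have h2 : ∫ t in Set.Ioi (0 : ℝ), Real.exp (-π * (t + x) ^ 2) ≤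
      ∫ t in Set.Ioi (0 : ℝ), Real.exp (-π * x ^ 2) * Real.exp (-π * t ^ 2) := by
    refine MeasureTheory.setIntegral_mono_on
      (integrable_gaussian_pi.comp_add_right x).integrableOn
      (integrable_gaussian_pi.const_mul _).integrableOn measurableSet_Ioi fun t ht ↦ ?_
    rw [← Real.exp_add]
    refine Real.exp_le_exp.2 ?_
    have := mul_nonneg Real.pi_pos.le (mul_nonneg (le_of_lt ht) hx)
    nlinarith
  rw [MeasureTheory.integral_const_mul, integral_gaussian_Ioi, div_self Real.pi_ne_zero,
    Real.sqrt_one] at h2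
  rw [one_sub_E, h1]
  linarith

/-- A bound for `sgn n - E((n + a) r)` that is uniform in `a ∈ [-B, B]`. -/
lemma abs_sign_sub_E_le {n a r B : ℝ} (hn : n ≠ 0) (hr : 0 < r) (ha : |a| ≤ B) :
    |Real.sign n - E ((n + a) * r)| ≤
      2 * Real.exp (π * r ^ 2 * B ^ 2) * Real.exp (-π * ((n + a) * r) ^ 2) := by
  have hpi := Real.pi_pos
  have h1 : 1 ≤ Real.exp (π * r ^ 2 * B ^ 2) := Real.one_le_exp (by positivity)
  -- If n and n + a have compatible signs, the tail estimate applies directly. Otherwise |n + a| ≤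
  -- |a| ≤ B, so the prefactor exp(πr²B²) outweighs the Gaussian and the trivial bound 2 suffices.
  by_cases hs : 0 ≤ n * (n + a)
  · have h2 : |Real.sign n - E ((n + a) * r)| ≤ Real.exp (-π * ((n + a) * r) ^ 2) := by
      rcases lt_or_gt_of_ne hn with h | h
      · have hx : 0 ≤ -((n + a) * r) := by
          have : n + a ≤ 0 := nonpos_of_mul_nonneg_right hs h
          nlinarith
        have h3 := one_sub_E_le hx
        have h4 := one_sub_E_nonneg (-((n + a) * r))
        rw [E_neg, even_two.neg_pow] at h3
        rw [E_neg] at h4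
        rw [Real.sign_of_neg h]
        exact abs_le.2 ⟨by linarith, by linarith [Real.exp_pos (-π * ((n + a) * r) ^ 2)]⟩
      · have hx : 0 ≤ (n + a) * r := mul_nonneg (nonneg_of_mul_nonneg_right hs h) hr.le
        have h3 := one_sub_E_le hx
        have h4 := one_sub_E_nonneg ((n + a) * r)
        rw [Real.sign_of_pos h]
        exact abs_le.2 ⟨by linarith [Real.exp_pos (-π * ((n + a) * r) ^ 2)], h3⟩
    nlinarith [Real.exp_pos (-π * ((n + a) * r) ^ 2)]
  · push Not at hs
    have h2 : |Real.sign n - E ((n + a) * r)| ≤ 2 := by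
      have h3 : |Real.sign n| ≤ 1 := by
        rcases Real.sign_apply_eq n with h | h | h <;> simp [h]
      calc _ ≤ |Real.sign n| + |E ((n + a) * r)| := abs_sub _ _
        _ ≤ 2 := by linarith [abs_E_le_one ((n + a) * r)]
    have h4 : (n + a) ^ 2 ≤ B ^ 2 := by
      have h5 : a ^ 2 ≤ B ^ 2 := sq_le_sq.2 (ha.trans (le_abs_self B))
      nlinarith [sq_nonneg n]
    have h6 : 1 ≤ Real.exp (π * r ^ 2 * B ^ 2) * Real.exp (-π * ((n + a) * r) ^ 2) := by
      rw [← Real.exp_add]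
      refine Real.one_le_exp ?_
      have := mul_nonneg (mul_nonneg hpi.le (sq_nonneg r)) (sub_nonneg.2 h4)
      nlinarith
    linarith

/-! ### The series `R` -/

/-- The summand of `R`. -/
def RTerm (k : ℤ) (u τ : ℂ) : ℂ :=
  ((Real.sign ((k : ℝ) + 1 / 2)
        - E (((k : ℝ) + 1 / 2 + u.im / τ.im) * √(2 * τ.im)) : ℝ) : ℂ)
      * (-1 : ℂ) ^ k
      * exp (-π * I * ((k : ℂ) + 1 / 2) ^ 2 * τ - 2 * π * I * ((k : ℂ) + 1 / 2) * u)

lemma R_eq_tsum (u τ : ℂ) : R u τ = ∑' k : ℤ, RTerm k u τ := rfl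

/-- A summable majorant for the series `R` and its derivatives. -/
def RBound (B : ℝ) (τ : ℂ) (k : ℤ) : ℝ :=
  Real.exp (π * τ.im * B) *
    Real.exp (-π * (τ.im * k ^ 2 - 2 * (τ.im * (1 + 2 * B) / 2) * |(k : ℝ)|))

lemma norm_R_exp (k : ℤ) (u τ : ℂ) :
    ‖exp (-π * I * ((k : ℂ) + 1 / 2) ^ 2 * τ - 2 * π * I * ((k : ℂ) + 1 / 2) * u)‖ =
      Real.exp (π * ((k : ℝ) + 1 / 2) ^ 2 * τ.im + 2 * π * ((k : ℝ) + 1 / 2) * u.im) := by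
  rw [Complex.norm_exp]
  congr 1
  have h : (-π * I * ((k : ℂ) + 1 / 2) ^ 2 * τ - 2 * π * I * ((k : ℂ) + 1 / 2) * u) =
      -(((π * ((k : ℝ) + 1 / 2) ^ 2 : ℝ) : ℂ) * (I * τ)
        + ((2 * π * ((k : ℝ) + 1 / 2) : ℝ) : ℂ) * (I * u)) := by
    push_cast
    ring
  rw [h, Complex.neg_re, Complex.add_re, Complex.re_ofReal_mul, Complex.re_ofReal_mul,
    Complex.I_mul_re, Complex.I_mul_re]
  ring

/-- With n = k + 1/2, a = Im u / Im τ and y = Im τ, the total exponent is -πy((n + a)² + a²): the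
decay from `E` has twice the quadratic rate of the growth of the exponential. -/
lemma gaussian_mul_norm_R_exp_le {τ u : ℂ} (hτ : 0 < τ.im) {B : ℝ} (hB : |u.im / τ.im| ≤ B)
    (k : ℤ) :
    Real.exp (-π * (((k : ℝ) + 1 / 2 + u.im / τ.im) * √(2 * τ.im)) ^ 2) *
      ‖exp (-π * I * ((k : ℂ) + 1 / 2) ^ 2 * τ - 2 * π * I * ((k : ℂ) + 1 / 2) * u)‖ ≤
      RBound B τ k := by
  rw [norm_R_exp, RBound, ← Real.exp_add, ← Real.exp_add, Real.exp_le_exp, mul_pow,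
    Real.sq_sqrt (by positivity)]
  obtain ⟨a, ha⟩ : ∃ a, a = u.im / τ.im := ⟨_, rfl⟩
  have hu : u.im = a * τ.im := by rw [ha]; field_simp
  rw [← ha] at hB ⊢
  rw [hu]
  have h0 : 0 ≤ B := (abs_nonneg a).trans hB
  have h1 : ((k : ℝ) + 1 / 2) * a ≥ -((|(k : ℝ)| + 1 / 2) * B) := by
    have h2 : |((k : ℝ) + 1 / 2) * a| ≤ (|(k : ℝ)| + 1 / 2) * B := by
      rw [abs_mul]
      refine mul_le_mul ((abs_add_le _ _).trans ?_) hB (abs_nonneg _) (by positivity)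
      rw [abs_of_pos (by norm_num : (0 : ℝ) < 1 / 2)]
    exact (abs_le.1 h2).1
  have h3 : -|(k : ℝ)| ≤ k := neg_abs_le _
  have key : 0 ≤ ((k : ℝ) + 1 / 2 + a) ^ 2 + a ^ 2 - (k ^ 2 - (1 + 2 * B) * |(k : ℝ)| - B) := by
    nlinarith [sq_nonneg a]
  have := mul_nonneg (mul_nonneg Real.pi_pos.le hτ.le) key
  nlinarith

/-- The factor |k| + 1 leaves room for the linear factor produced by differentiating the
exponential. -/
lemma summable_RBound {τ : ℂ} (hτ : 0 < τ.im) (B : ℝ) :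
    Summable fun k : ℤ ↦ (|(k : ℝ)| + 1) * RBound B τ k := by
  have h0 := summable_pow_mul_jacobiTheta₂_term_bound (τ.im * (1 + 2 * B) / 2) hτ 0
  have h1 := summable_pow_mul_jacobiTheta₂_term_bound (τ.im * (1 + 2 * B) / 2) hτ 1
  refine ((h1.add h0).mul_left (Real.exp (π * τ.im * B))).congr fun k ↦ ?_
  simp only [RBound, pow_zero, pow_one, Int.cast_abs]
  ring

lemma RBound_nonneg (B : ℝ) (τ : ℂ) (k : ℤ) : 0 ≤ RBound B τ k := by
  unfold RBound
  positivity

lemma int_add_half_ne_zero (k : ℤ) : (k : ℝ) + 1 / 2 ≠ 0 := by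
  intro h
  have h2 : 2 * k + 1 = 0 := by
    have : (2 * k + 1 : ℝ) = 0 := by linarith
    exact_mod_cast this
  omega

lemma norm_RTerm_le {τ u : ℂ} (hτ : 0 < τ.im) {B : ℝ} (hB : |u.im / τ.im| ≤ B) (k : ℤ) :
    ‖RTerm k u τ‖ ≤ 2 * Real.exp (π * (2 * τ.im) * B ^ 2) * RBound B τ k := by
  have h1 := abs_sign_sub_E_le (int_add_half_ne_zero k) (Real.sqrt_pos.2 (by positivity)) hB
    (r := √(2 * τ.im))
  rw [Real.sq_sqrt (by positivity)] at h1
  rw [RTerm, norm_mul, norm_mul, norm_zpow, norm_neg, norm_one, one_zpow, mul_one,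
    Complex.norm_real, Real.norm_eq_abs]
  refine (mul_le_mul_of_nonneg_right h1 (norm_nonneg _)).trans ?_
  rw [mul_assoc]
  exact mul_le_mul_of_nonneg_left (gaussian_mul_norm_R_exp_le hτ hB k) (by positivity)

lemma summable_RTerm {τ : ℂ} (hτ : 0 < τ.im) (u : ℂ) : Summable fun k : ℤ ↦ RTerm k u τ := by
  refine ((summable_RBound hτ |u.im / τ.im|).mul_left
    (2 * Real.exp (π * (2 * τ.im) * |u.im / τ.im| ^ 2))).of_norm_bounded fun k ↦ ?_
  refine (norm_RTerm_le hτ le_rfl k).trans ?_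
  refine mul_le_mul_of_nonneg_left ?_ (by positivity)
  nlinarith [RBound_nonneg |u.im / τ.im| τ k, abs_nonneg (k : ℝ)]

lemma R_add_one (u τ : ℂ) : R (u + 1) τ = -R u τ := by
  rw [R_eq_tsum, R_eq_tsum, ← tsum_neg]
  refine tsum_congr fun k ↦ ?_
  have h : exp (-π * I * ((k : ℂ) + 1 / 2) ^ 2 * τ - 2 * π * I * ((k : ℂ) + 1 / 2) * (u + 1)) =
      -exp (-π * I * ((k : ℂ) + 1 / 2) ^ 2 * τ - 2 * π * I * ((k : ℂ) + 1 / 2) * u) := by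
    rw [← neg_one_mul (exp _), ← Complex.exp_pi_mul_I, ← Complex.exp_add,
      Complex.exp_eq_exp_iff_exists_int]
    exact ⟨-k - 1, by push_cast; ring⟩
  rw [RTerm, RTerm, h, Complex.add_im, Complex.one_im, add_zero]
  ring

lemma sign_sub_sign (k : ℤ) : Real.sign ((k : ℝ) + 1 / 2) - Real.sign ((k : ℝ) + 1 / 2 - 1) =
    if k = 0 then 2 else 0 := by
  rcases lt_trichotomy k 0 with h | h | h
  · have h1 : (k : ℝ) ≤ -1 := by exact_mod_cast (by omega : k ≤ -1)
    rw [Real.sign_of_neg (by linarith), Real.sign_of_neg (by linarith), if_neg h.ne, sub_self]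
  · subst h
    rw [Real.sign_of_pos (by norm_num), Real.sign_of_neg (by norm_num)]
    norm_num
  · have h1 : (1 : ℝ) ≤ k := by exact_mod_cast h
    rw [Real.sign_of_pos (by linarith), Real.sign_of_pos (by linarith), if_neg h.ne', sub_self]

/-- The shift raises Im u / Im τ by 1, which the substitution k ↦ k - 1 undoes inside `E`. Only the
sign term changes, and it jumps at the single index k = 0, which yields the inhomogeneous term. -/
lemma R_add_self {τ : ℂ} (hτ : 0 < τ.im) (u : ℂ) :
    R (u + τ) τ = exp (π * I * τ + 2 * π * I * u) *
      (2 * exp (-π * I * τ / 4 - π * I * u) - R u τ) := by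
  have h1 : R (u + τ) τ = ∑' k : ℤ, RTerm (k - 1) (u + τ) τ :=
    ((Equiv.subRight (1 : ℤ)).tsum_eq fun k ↦ RTerm k (u + τ) τ).symm
  have hterm (k : ℤ) : RTerm (k - 1) (u + τ) τ = exp (π * I * τ + 2 * π * I * u) *
      ((if k = 0 then 2 * exp (-π * I * τ / 4 - π * I * u) else 0) - RTerm k u τ) := by
    have hb : (u + τ).im / τ.im = u.im / τ.im + 1 := by
      rw [Complex.add_im, add_div, div_self hτ.ne']
    have h2 : exp (-π * I * (((k - 1 : ℤ) : ℂ) + 1 / 2) ^ 2 * τ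
        - 2 * π * I * (((k - 1 : ℤ) : ℂ) + 1 / 2) * (u + τ)) =
        exp (π * I * τ + 2 * π * I * u) *
        exp (-π * I * ((k : ℂ) + 1 / 2) ^ 2 * τ - 2 * π * I * ((k : ℂ) + 1 / 2) * u) := by
      rw [← Complex.exp_add]
      push_cast
      ring_nf
    have h3 : ((k - 1 : ℤ) : ℝ) + 1 / 2 + (u.im / τ.im + 1) = k + 1 / 2 + u.im / τ.im := by
      push_cast; ring
    have h4 : ((k - 1 : ℤ) : ℝ) + 1 / 2 = k + 1 / 2 - 1 := by push_cast; ring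
    have h5 : Real.sign ((k : ℝ) + 1 / 2 - 1) =
        Real.sign ((k : ℝ) + 1 / 2) - if k = 0 then 2 else 0 := by
      rw [← sign_sub_sign]; ring
    have h6 : (-1 : ℂ) ^ (k - 1) = -(-1) ^ k := by
      rw [zpow_sub_one₀ (by norm_num)]; norm_num
    rw [RTerm, RTerm, hb, h2, h3, h4, h5, h6]
    split_ifs with hk
    · subst hk
      have h7 : -π * I * (((0 : ℤ) : ℂ) + 1 / 2) ^ 2 * τ - 2 * π * I * (((0 : ℤ) : ℂ) + 1 / 2) * u
          = -π * I * τ / 4 - π * I * u := by push_cast; ring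
      rw [h7]
      push_cast
      ring
    · push_cast
      ring
  rw [h1]
  simp_rw [hterm]
  rw [tsum_mul_left, Summable.tsum_sub (hasSum_ite_eq 0 _).summable (summable_RTerm hτ u),
    tsum_ite_eq, R_eq_tsum]

lemma R_add_one_modulus (u τ : ℂ) : R u (τ + 1) = exp (-π * I / 4) * R u τ := by
  rw [R_eq_tsum, R_eq_tsum, ← tsum_mul_left]
  refine tsum_congr fun k ↦ ?_
  have h : exp (-π * I * ((k : ℂ) + 1 / 2) ^ 2 * (τ + 1) - 2 * π * I * ((k : ℂ) + 1 / 2) * u) =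
      exp (-π * I / 4) *
      exp (-π * I * ((k : ℂ) + 1 / 2) ^ 2 * τ - 2 * π * I * ((k : ℂ) + 1 / 2) * u) := by
    rw [← Complex.exp_add, Complex.exp_eq_exp_iff_exists_int]
    obtain ⟨j, hj⟩ := Int.even_mul_succ_self k
    refine ⟨-j, ?_⟩
    have hj' : (k : ℂ) * (k + 1) = j + j := by exact_mod_cast hj
    push_cast
    linear_combination (-π * I) * hj'
  rw [RTerm, RTerm, h, Complex.add_im, Complex.one_im, add_zero]
  ring

/-! ### The real derivative of `R` -/

/-- The coefficient of `Im du` in the real derivative of the `k`-th summand of `R`. -/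
def RTermDerivIm (k : ℤ) (u τ : ℂ) : ℂ :=
  ((-2 * Real.exp (-π * (((k : ℝ) + 1 / 2 + u.im / τ.im) * √(2 * τ.im)) ^ 2)
    * (√(2 * τ.im) / τ.im) : ℝ) : ℂ) * (-1 : ℂ) ^ k
      * exp (-π * I * ((k : ℂ) + 1 / 2) ^ 2 * τ - 2 * π * I * ((k : ℂ) + 1 / 2) * u)

lemma hasFDerivAt_RTerm (k : ℤ) (u τ : ℂ) :
    HasFDerivAt (fun w ↦ RTerm k w τ)
      (RTermDerivIm k u τ • Complex.ofRealCLM.comp Complex.imCLM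
        + (-2 * π * I * ((k : ℂ) + 1 / 2) * RTerm k u τ) • ContinuousLinearMap.id ℝ ℂ) u := by
  have him : HasFDerivAt (fun w : ℂ ↦ w.im) Complex.imCLM u := Complex.imCLM.hasFDerivAt
  have harg : HasFDerivAt (fun w : ℂ ↦ ((k : ℝ) + 1 / 2 + w.im / τ.im) * √(2 * τ.im))
      ((√(2 * τ.im) / τ.im) • Complex.imCLM) u := by
    have h := ((him.mul_const (τ.im)⁻¹).const_add ((k : ℝ) + 1 / 2)).mul_const (√(2 * τ.im))
    refine h.congr_fderiv ?_
    rw [smul_smul, div_eq_mul_inv]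
  have hE := ((hasDerivAt_E _).comp_hasFDerivAt u harg).const_sub (Real.sign ((k : ℝ) + 1 / 2))
  have hEc := Complex.ofRealCLM.hasFDerivAt.comp u hE
  have hexp : HasFDerivAt (fun w : ℂ ↦
      exp (-π * I * ((k : ℂ) + 1 / 2) ^ 2 * τ - 2 * π * I * ((k : ℂ) + 1 / 2) * w))
      ((exp (-π * I * ((k : ℂ) + 1 / 2) ^ 2 * τ - 2 * π * I * ((k : ℂ) + 1 / 2) * u)
        * (-2 * π * I * ((k : ℂ) + 1 / 2))) • ContinuousLinearMap.id ℝ ℂ) u := by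
    have h : HasDerivAt (fun w : ℂ ↦
        exp (-π * I * ((k : ℂ) + 1 / 2) ^ 2 * τ - 2 * π * I * ((k : ℂ) + 1 / 2) * w))
        (exp (-π * I * ((k : ℂ) + 1 / 2) ^ 2 * τ - 2 * π * I * ((k : ℂ) + 1 / 2) * u)
        * (-2 * π * I * ((k : ℂ) + 1 / 2))) u := by
      have := (((hasDerivAt_id u).const_mul (2 * π * I * ((k : ℂ) + 1 / 2))).const_sub
        (-π * I * ((k : ℂ) + 1 / 2) ^ 2 * τ)).cexp
      simp only [id] at this
      refine this.congr_deriv ?_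
      ring
    refine (h.hasFDerivAt.restrictScalars ℝ).congr_fderiv ?_
    refine ContinuousLinearMap.ext fun w ↦ ?_
    simp
    ring
  have hmul := (hEc.mul_const ((-1 : ℂ) ^ k)).mul hexp
  refine hmul.congr_fderiv ?_
  refine ContinuousLinearMap.ext fun w ↦ ?_
  simp [RTermDerivIm, RTerm]
  ring

lemma norm_RTermDerivIm_le {τ u : ℂ} (hτ : 0 < τ.im) {B : ℝ} (hB : |u.im / τ.im| ≤ B) (k : ℤ) :
    ‖RTermDerivIm k u τ‖ ≤ 2 * (√(2 * τ.im) / τ.im) * RBound B τ k := by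
  rw [RTermDerivIm, norm_mul, norm_mul, norm_zpow, norm_neg, norm_one, one_zpow, mul_one,
    Complex.norm_real, Real.norm_eq_abs, abs_mul, abs_mul, abs_neg, abs_two,
    abs_of_pos (Real.exp_pos _), abs_of_nonneg (by positivity : 0 ≤ √(2 * τ.im) / τ.im)]
  have h := mul_le_mul_of_nonneg_left (gaussian_mul_norm_R_exp_le hτ hB k)
    (by positivity : 0 ≤ 2 * (√(2 * τ.im) / τ.im))
  refine le_trans (le_of_eq ?_) h
  ring

lemma norm_linear_RTerm_le {τ u : ℂ} (hτ : 0 < τ.im) {B : ℝ} (hB : |u.im / τ.im| ≤ B) (k : ℤ) :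
    ‖-2 * π * I * ((k : ℂ) + 1 / 2) * RTerm k u τ‖ ≤
      4 * π * Real.exp (π * (2 * τ.im) * B ^ 2) * ((|(k : ℝ)| + 1) * RBound B τ k) := by
  have h1 : ‖-2 * π * I * ((k : ℂ) + 1 / 2)‖ ≤ 2 * π * (|(k : ℝ)| + 1) := by
    have h2 : ‖(k : ℂ) + 1 / 2‖ ≤ |(k : ℝ)| + 1 := by
      refine (norm_add_le _ _).trans ?_
      rw [Complex.norm_intCast]
      norm_num
    rw [norm_mul, norm_mul, norm_mul, Complex.norm_I, Complex.norm_real, norm_neg,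
      Complex.norm_two, mul_one, Real.norm_of_nonneg Real.pi_pos.le]
    exact mul_le_mul_of_nonneg_left h2 Real.two_pi_pos.le
  rw [norm_mul]
  refine (mul_le_mul h1 (norm_RTerm_le hτ hB k) (norm_nonneg _) (by positivity)).trans
    (le_of_eq ?_)
  ring

/-- The derivative of `R` in terms of `dū`: it is a multiple of the complex conjugate of `ϑ`. -/
def RConjDeriv (u τ : ℂ) : ℂ :=
  conj (((√(2 * τ.im) / τ.im * Real.exp (-2 * π * u.im ^ 2 / τ.im) : ℝ) : ℂ) * vartheta u τ)

/-- The Gaussian from E' completes each exponential of R to the complex conjugate of a theta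
summand, up to a factor independent of k. The factor i/2 is the coefficient of dū in d(Im u). -/
lemma tsum_RTermDerivIm {τ : ℂ} (hτ : 0 < τ.im) (u : ℂ) :
    I / 2 * ∑' k : ℤ, RTermDerivIm k u τ = RConjDeriv u τ := by
  rw [RConjDeriv, vartheta, map_mul, Complex.conj_tsum, ← tsum_mul_left, ← tsum_mul_left]
  refine tsum_congr fun k ↦ ?_
  have hexp : -I * ((Real.exp (-π * (((k : ℝ) + 1 / 2 + u.im / τ.im) * √(2 * τ.im)) ^ 2) : ℝ) : ℂ) *
      (-1 : ℂ) ^ k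
      * exp (-π * I * ((k : ℂ) + 1 / 2) ^ 2 * τ - 2 * π * I * ((k : ℂ) + 1 / 2) * u) =
      ((Real.exp (-2 * π * u.im ^ 2 / τ.im) : ℝ) : ℂ) *
        conj (exp (π * I * ((k : ℂ) + 1 / 2) ^ 2 * τ
          + 2 * π * I * ((k : ℂ) + 1 / 2) * (u + 1 / 2))) := by
    have hyC : (τ.im : ℂ) ≠ 0 := by exact_mod_cast hτ.ne'
    rw [mul_pow, Real.sq_sqrt (by positivity), ← exp_pi_mul_I_mul_int, ← Complex.exp_conj]
    have h1 : conj (π * I * ((k : ℂ) + 1 / 2) ^ 2 * τ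
          + 2 * π * I * ((k : ℂ) + 1 / 2) * (u + 1 / 2)) =
        -(π * I * ((k : ℂ) + 1 / 2) ^ 2 * (τ - 2 * τ.im * I)
          + 2 * π * I * ((k : ℂ) + 1 / 2) * (u - 2 * u.im * I + 1 / 2)) := by
      have hc (z : ℂ) : conj z = z - 2 * z.im * I := by
        apply Complex.ext <;> simp; ring
      rw [← hc, ← hc]
      simp only [map_add, map_mul, map_pow, Complex.conj_ofReal, Complex.conj_I, map_ofNat,
        map_intCast, map_one, map_div₀]
      ring
    rw [h1, Complex.ofReal_exp, Complex.ofReal_exp, neg_I_mul_exp, ← Complex.exp_add,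
      ← Complex.exp_add, ← Complex.exp_add, Complex.exp_eq_exp_iff_exists_int]
    refine ⟨k, ?_⟩
    push_cast
    field_simp
    ring_nf
    rw [Complex.I_sq]
    ring
  rw [RTermDerivIm]
  rw [Complex.conj_ofReal]
  push_cast at hexp ⊢
  linear_combination (√(2 * τ.im) / τ.im : ℂ) * hexp

/-- Termwise differentiation on a strip where the majorant is uniform. The holomorphic coefficient p
stays anonymous because only the conjugate-linear part obstructs complex differentiability. -/
theorem exists_hasFDerivAt_R {τ : ℂ} (hτ : 0 < τ.im) (u : ℂ) :
    ∃ p : ℂ, HasFDerivAt (fun w ↦ R w τ)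
      (p • ContinuousLinearMap.id ℝ ℂ + RConjDeriv u τ • (Complex.conjCLE : ℂ →L[ℝ] ℂ)) u := by
  set B : ℝ := |u.im / τ.im| + 1 with hB
  let s : Set ℂ := {w | |w.im / τ.im| < B}
  have hcont : Continuous fun w : ℂ ↦ |w.im / τ.im| := by fun_prop
  have hopen : IsOpen s := isOpen_lt hcont continuous_const
  have hu : u ∈ s := by simp [s, hB]
  have hconn : IsPreconnected s := by
    have hs : s = Complex.imCLM ⁻¹' ((fun x : ℝ ↦ x / τ.im) ⁻¹' Set.Ioo (-B) B) := by
      ext w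
      simp [s, abs_lt]
    have h1 : (fun x : ℝ ↦ x / τ.im) ⁻¹' Set.Ioo (-B) B = Set.Ioo (-B * τ.im) (B * τ.im) := by
      ext x
      simp [lt_div_iff₀ hτ, div_lt_iff₀ hτ]
    rw [hs, h1]
    exact ((convex_Ioo _ _).linear_preimage Complex.imCLM.toLinearMap).isPreconnected
  set C : ℝ := 2 * (√(2 * τ.im) / τ.im) + 4 * π * Real.exp (π * (2 * τ.im) * B ^ 2) with hC
  have hb1 (k : ℤ) : RBound B τ k ≤ (|(k : ℝ)| + 1) * RBound B τ k := by
    nlinarith [RBound_nonneg B τ k, abs_nonneg (k : ℝ)]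
  have hbd1 (k : ℤ) (w : ℂ) (hw : w ∈ s) : ‖RTermDerivIm k w τ‖ ≤
      2 * (√(2 * τ.im) / τ.im) * ((|(k : ℝ)| + 1) * RBound B τ k) :=
    (norm_RTermDerivIm_le hτ (le_of_lt hw) k).trans
      (mul_le_mul_of_nonneg_left (hb1 k) (by positivity))
  have hbd2 (k : ℤ) (w : ℂ) (hw : w ∈ s) := norm_linear_RTerm_le hτ (le_of_lt hw) k
  have hsum := summable_RBound hτ B
  have hs1 : Summable fun k : ℤ ↦ RTermDerivIm k u τ :=
    (hsum.mul_left _).of_norm_bounded fun k ↦ hbd1 k u hu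
  have hs2 : Summable fun k : ℤ ↦ -2 * π * I * ((k : ℂ) + 1 / 2) * RTerm k u τ :=
    (hsum.mul_left _).of_norm_bounded fun k ↦ hbd2 k u hu
  have hD := hasFDerivAt_tsum_of_isPreconnected (𝕜 := ℝ) (hsum.mul_left C) hopen hconn
    (fun k w _ ↦ hasFDerivAt_RTerm k w τ) (fun k w hw ↦ ?_) hu (summable_RTerm hτ u) hu
  · refine ⟨-I / 2 * ∑' k : ℤ, RTermDerivIm k u τ
      + ∑' k : ℤ, -2 * π * I * ((k : ℂ) + 1 / 2) * RTerm k u τ, hD.congr_fderiv ?_⟩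
    rw [Summable.tsum_add (hs1.smul_const _) (hs2.smul_const _), hs1.tsum_smul_const,
      hs2.tsum_smul_const, ← tsum_RTermDerivIm hτ]
    refine ContinuousLinearMap.ext fun w ↦ ?_
    have him : (w.im : ℂ) = -I / 2 * w + I / 2 * conj w := by
      apply Complex.ext <;> simp <;> ring
    simp [him]
    ring
  · have h1 : ‖Complex.ofRealCLM.comp Complex.imCLM‖ ≤ 1 := by
      refine ContinuousLinearMap.opNorm_le_bound _ zero_le_one fun z ↦ ?_
      simpa using Complex.abs_im_le_norm z
    have h2 : ‖ContinuousLinearMap.id ℝ ℂ‖ ≤ 1 := ContinuousLinearMap.norm_id_le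
    refine (norm_add_le _ _).trans ?_
    rw [norm_smul, norm_smul, hC, add_mul]
    refine add_le_add ?_ ?_
    · exact (mul_le_of_le_one_right (norm_nonneg _) h1).trans (hbd1 k w hw)
    · exact (mul_le_of_le_one_right (norm_nonneg _) h2).trans (hbd2 k w hw)

/-! ### Elliptic transformations of `μ̃` -/

lemma muTilde_add_one (u v τ : ℂ) : muTilde (u + 1) v τ = -muTilde u v τ := by
  rw [muTilde, muTilde, mu_add_one, show u + 1 - v = u - v + 1 by ring, R_add_one]
  ring

/-- The inhomogeneous terms of `mu_add_self` and `R_add_self` cancel; this is what the correction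
(i/2)R achieves. -/
lemma muTilde_add_self {τ u v : ℂ} (hτ : 0 < τ.im) (hu : u ∉ lattice τ) (hv : v ∉ lattice τ) :
    muTilde (u + τ) v τ = -exp (π * I * τ + 2 * π * I * (u - v)) * muTilde u v τ := by
  have h : exp (π * I * τ + 2 * π * I * (u - v)) * exp (-π * I * τ / 4 - π * I * (u - v)) =
      exp (π * I * (u - v) + 3 * π * I * τ / 4) := by
    rw [← Complex.exp_add]
    ring_nf
  rw [muTilde, muTilde, mu_add_self hτ hu hv, show u + τ - v = u - v + τ by ring, R_add_self hτ]
  linear_combination I * h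

lemma muTilde_add_one_right (u v τ : ℂ) : muTilde u (v + 1) τ = -muTilde u v τ := by
  have h := R_add_one (u - v - 1) τ
  rw [sub_add_cancel] at h
  rw [muTilde, muTilde, mu_add_one_right, show u - (v + 1) = u - v - 1 by ring, h]
  ring

lemma muTilde_add_self_right {τ u v : ℂ} (hτ : 0 < τ.im) (hu : u ∉ lattice τ)
    (hv : v ∉ lattice τ) :
    muTilde u (v + τ) τ = -exp (π * I * τ - 2 * π * I * (u - v)) * muTilde u v τ := by
  have h := R_add_self hτ (u - v - τ)
  rw [sub_add_cancel] at h
  have h1 : exp (π * I * τ - 2 * π * I * (u - v)) * exp (π * I * τ + 2 * π * I * (u - v - τ)) =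
      1 := by
    rw [← Complex.exp_add, ← Complex.exp_zero]
    ring_nf
  have h2 : exp (-π * I * τ / 4 - π * I * (u - v - τ)) =
      exp (-π * I * (u - v) + 3 * π * I * τ / 4) := by
    ring_nf
  rw [h2] at h
  rw [muTilde, muTilde, mu_add_self_right hτ hu hv, show u - (v + τ) = u - v - τ by ring, h]
  linear_combination (I / 2 * (R (u - v - τ) τ
    - 2 * exp (-π * I * (u - v) + 3 * π * I * τ / 4))) * (-h1)

lemma muTilde_add_one_modulus (u v τ : ℂ) :
    muTilde u v (τ + 1) = exp (-π * I / 4) * muTilde u v τ := by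
  rw [muTilde, muTilde, mu_add_one_modulus, R_add_one_modulus]
  ring

/-! ### The inversion `τ ↦ -1/τ` -/

lemma im_neg_one_div (τ : ℂ) : (-1 / τ).im = τ.im / ‖τ‖ ^ 2 := by
  rw [neg_div, one_div, Complex.neg_im, Complex.inv_im, Complex.normSq_eq_norm_sq]
  ring

lemma div_mem_lattice_iff {τ : ℂ} (h0 : τ ≠ 0) (z : ℂ) :
    z / τ ∈ lattice (-1 / τ) ↔ z ∈ lattice τ := by
  constructor
  · rintro ⟨m, n, h⟩
    refine ⟨-n, m, ?_⟩
    field_simp at h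
    rw [h]
    push_cast
    ring
  · rintro ⟨m, n, rfl⟩
    refine ⟨n, -m, ?_⟩
    field_simp
    push_cast
    ring

/-- The factor `√(-iτ)`. -/
def invFactor (τ : ℂ) : ℂ := (-I * τ) ^ (1 / 2 : ℂ)

lemma invFactor_sq (τ : ℂ) : invFactor τ ^ 2 = -I * τ := by
  rw [invFactor, ← Complex.cpow_nat_mul]
  norm_num

lemma invFactor_ne_zero {τ : ℂ} (h0 : τ ≠ 0) : invFactor τ ≠ 0 := by
  intro h
  have := invFactor_sq τ
  simp [h, h0] at this

lemma invFactor_mul_conj (τ : ℂ) : invFactor τ * conj (invFactor τ) = (‖τ‖ : ℂ) := by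
  have h := congrArg norm (invFactor_sq τ)
  rw [norm_pow, norm_mul, norm_neg, Complex.norm_I, one_mul] at h
  rw [Complex.mul_conj, Complex.normSq_eq_norm_sq, h]

lemma vartheta_inversion {τ : ℂ} (h0 : τ ≠ 0) (u : ℂ) :
    vartheta (u / τ) (-1 / τ) =
      -I * invFactor τ * exp (π * I * u ^ 2 / τ) * vartheta u τ := by
  have hs := invFactor_ne_zero h0
  have hJ := jacobiTheta₂_functional_equation (u - 1 / 2 + τ / 2) τ
  -- The representative u - 1/2 + τ/2 is chosen because its quotient by τ is exactly the argument
  -- u/τ + 1/2 - 1/(2τ) occurring at modulus -1/τ.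
  rw [← jacobiTheta₂_add_left, show u - 1 / 2 + τ / 2 + 1 = u + 1 / 2 + τ / 2 by ring] at hJ
  rw [vartheta_eq, vartheta_eq, hJ,
    show u / τ + 1 / 2 + -1 / τ / 2 = (u - 1 / 2 + τ / 2) / τ by field_simp; ring]
  have h1 : -I * exp (π * I * u ^ 2 / τ) * exp (π * I * τ / 4 + π * I * (u + 1 / 2)) *
      exp (-π * I * (u - 1 / 2 + τ / 2) ^ 2 / τ) =
      exp (π * I * (-1 / τ) / 4 + π * I * (u / τ + 1 / 2)) := by
    rw [neg_I_mul_exp, ← Complex.exp_add, ← Complex.exp_add]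
    congr 1
    field_simp
    ring
  rw [← h1]
  change _ = -I * invFactor τ * exp (π * I * u ^ 2 / τ) *
    (exp (π * I * τ / 4 + π * I * (u + 1 / 2)) * (1 / invFactor τ * _ * _))
  generalize exp (-π * I * (u - 1 / 2 + τ / 2) ^ 2 / τ) = x₁
  generalize exp (π * I * τ / 4 + π * I * (u + 1 / 2)) = x₂
  generalize exp (π * I * u ^ 2 / τ) = x₃
  field_simp

lemma gaussian_inversion {τ : ℂ} (hτ : 0 < τ.im) (u : ℂ) :
    conj (exp (π * I * u ^ 2 / τ)) * exp (π * I * u ^ 2 / τ) *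
      ((Real.exp (-2 * π * (u / τ).im ^ 2 / (-1 / τ).im) : ℝ) : ℂ) =
      ((Real.exp (-2 * π * u.im ^ 2 / τ.im) : ℝ) : ℂ) := by
  have h0 : τ ≠ 0 := by
    rintro rfl
    simp at hτ
  obtain ⟨w, rfl⟩ : ∃ w, u = w * τ := ⟨u / τ, by field_simp⟩
  rw [show π * I * (w * τ) ^ 2 / τ = π * (I * (w ^ 2 * τ)) by field_simp,
    mul_div_cancel_right₀ _ h0,
    ← Complex.exp_conj, ← Complex.exp_add, add_comm, Complex.add_conj, Complex.re_ofReal_mul,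
    ← Complex.ofReal_exp, ← Complex.ofReal_mul, ← Real.exp_add, im_neg_one_div,
    ← Complex.normSq_eq_norm_sq, Complex.normSq_apply, Complex.I_mul_re]
  congr 2
  have hn : τ.re * τ.re + τ.im * τ.im ≠ 0 := by
    have := mul_pos hτ hτ
    have := mul_self_nonneg τ.re
    exact ne_of_gt (by linarith)
  simp only [pow_two, Complex.mul_im, Complex.mul_re]
  field_simp
  ring

/-- This is the conjugate of the inversion formula for ϑ, with the Gaussian weights matched by
`gaussian_inversion`. The factor conj τ⁻¹ is the chain rule for u ↦ u/τ. -/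
lemma RConjDeriv_inversion {τ : ℂ} (hτ : 0 < τ.im) (u : ℂ) :
    RConjDeriv u τ + 1 / invFactor τ * exp (π * I * u ^ 2 / τ) *
      (RConjDeriv (u / τ) (-1 / τ) * conj τ⁻¹) = 0 := by
  have h0 : τ ≠ 0 := by
    rintro rfl
    simp at hτ
  have hs := invFactor_ne_zero h0
  have hn : (‖τ‖ : ℝ) ≠ 0 := norm_ne_zero_iff.2 h0
  have hnC : (‖τ‖ : ℂ) ≠ 0 := by exact_mod_cast hn
  apply (starRingEnd ℂ).injective
  simp only [RConjDeriv, map_add, map_mul, Complex.conj_conj, map_zero]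
  have hsq : √(2 * (-1 / τ).im) / (-1 / τ).im = ‖τ‖ * (√(2 * τ.im) / τ.im) := by
    rw [im_neg_one_div, mul_div_assoc', Real.sqrt_div' _ (by positivity),
      Real.sqrt_sq (norm_nonneg _)]
    field_simp
  have hg := gaussian_inversion hτ u
  have hc : conj (1 / invFactor τ) = invFactor τ / ‖τ‖ := by
    rw [map_div₀, map_one, ← invFactor_mul_conj]
    have : conj (invFactor τ) ≠ 0 := by simpa using hs
    field_simp
  rw [hsq, vartheta_inversion h0, hc]
  have hq := invFactor_sq τ
  push_cast at hg ⊢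
  generalize conj (exp (π * I * u ^ 2 / τ)) = x₁ at *
  generalize exp (π * I * u ^ 2 / τ) = x₂ at *
  rw [← hg]
  field_simp
  rw [hq]
  ring_nf
  rw [Complex.I_sq]
  ring

/-- The Cauchy–Riemann criterion: a real derivative that is multiplication by a complex number is a
complex derivative. -/
lemma differentiableAt_of_hasFDerivAt_smul_id {f : ℂ → ℂ} {p u : ℂ}
    (h : HasFDerivAt f (p • ContinuousLinearMap.id ℝ ℂ) u) : DifferentiableAt ℂ f u :=
  (hasFDerivAt_of_restrictScalars ℝ (f' := p • ContinuousLinearMap.id ℂ ℂ) h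
    (ContinuousLinearMap.ext fun _ ↦ rfl)).differentiableAt

/-- The non-holomorphic parts of `R(u;τ)` and its inversion cancel. -/
lemma differentiable_R_add_inversion {τ : ℂ} (hτ : 0 < τ.im) :
    Differentiable ℂ fun u ↦
      R u τ + 1 / invFactor τ * exp (π * I * u ^ 2 / τ) * R (u / τ) (-1 / τ) := by
  intro u
  have hτ' : 0 < (-1 / τ).im := by
    have h0 : τ ≠ 0 := by
      rintro rfl
      simp at hτ
    rw [im_neg_one_div]
    positivity
  obtain ⟨p, hp⟩ := exists_hasFDerivAt_R hτ u
  obtain ⟨p', hp'⟩ := exists_hasFDerivAt_R hτ' (u / τ)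
  have hdiv : HasFDerivAt (fun w : ℂ ↦ w / τ) (τ⁻¹ • ContinuousLinearMap.id ℝ ℂ) u := by
    have := ((hasDerivAt_id u).div_const τ).hasFDerivAt.restrictScalars ℝ
    refine this.congr_fderiv (ContinuousLinearMap.ext fun w ↦ ?_)
    simp [div_eq_mul_inv, mul_comm]
  have hcomp := hp'.comp u hdiv
  have hexp : HasDerivAt (fun w : ℂ ↦ 1 / invFactor τ * exp (π * I * w ^ 2 / τ))
      (deriv (fun w : ℂ ↦ 1 / invFactor τ * exp (π * I * w ^ 2 / τ)) u) u :=
    DifferentiableAt.hasDerivAt (by fun_prop)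
  generalize deriv (fun w : ℂ ↦ 1 / invFactor τ * exp (π * I * w ^ 2 / τ)) u = d at hexp
  have hsum := hp.add ((hexp.hasFDerivAt.restrictScalars ℝ).mul hcomp)
  refine differentiableAt_of_hasFDerivAt_smul_id
    (p := p + 1 / invFactor τ * exp (π * I * u ^ 2 / τ) * p' * τ⁻¹
      + d * R (u / τ) (-1 / τ)) (hsum.congr_fderiv ?_)
  refine ContinuousLinearMap.ext fun w ↦ ?_
  have key := RConjDeriv_inversion hτ u
  simp only [map_inv₀] at key
  simp
  simp at key
  linear_combination conj w * key

/-- The difference of the two sides, suitably normalised, is a function of u to which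
`vartheta_mul_eq_zero` applies. Inversion exchanges the periods 1 and τ, so each quasi-periodicity
of `f` combines one elliptic law at τ with the other one at -1/τ. -/
theorem muTilde_inversion {τ u v : ℂ} (hτ : 0 < τ.im) (hu : u ∉ lattice τ) (hv : v ∉ lattice τ) :
    muTilde (u / τ) (v / τ) (-1 / τ) =
      -invFactor τ * exp (-π * I * (u - v) ^ 2 / τ) * muTilde u v τ := by
  have h0 : τ ≠ 0 := by
    rintro rfl
    simp at hτ
  have hτ' : 0 < (-1 / τ).im := by
    rw [im_neg_one_div]
    positivity
  have hs := invFactor_ne_zero h0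
  have hv' : v / τ ∉ lattice (-1 / τ) := mt (div_mem_lattice_iff h0 v).1 hv
  let f : ℂ → ℂ := fun u ↦ muTilde u v τ +
    1 / invFactor τ * exp (π * I * (u - v) ^ 2 / τ) * muTilde (u / τ) (v / τ) (-1 / τ)
  -- The two R-terms are grouped into an entire function, so only the `mu`-terms contribute poles.
  have hf (u : ℂ) : f u = mu u v τ + 1 / invFactor τ * exp (π * I * (u - v) ^ 2 / τ) *
      mu (u / τ) (v / τ) (-1 / τ) + I / 2 * (R (u - v) τ + 1 / invFactor τ *
        exp (π * I * (u - v) ^ 2 / τ) * R ((u - v) / τ) (-1 / τ)) := by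
    simp only [f, muTilde, sub_div]
    ring
  have hr : Differentiable ℂ fun u ↦ R (u - v) τ + 1 / invFactor τ *
      exp (π * I * (u - v) ^ 2 / τ) * R ((u - v) / τ) (-1 / τ) :=
    (differentiable_R_add_inversion hτ).comp (differentiable_id.sub_const v)
  have hzero : vartheta u τ * f u = 0 := by
    refine vartheta_mul_eq_zero hτ hv ?_ ?_ ?_ ?_ hu
    · intro w hw
      have h1 := differentiableAt_mu hτ hw v
      have h2 : DifferentiableAt ℂ (fun w ↦ mu (w / τ) (v / τ) (-1 / τ)) w :=
        (differentiableAt_mu hτ' (mt (div_mem_lattice_iff h0 w).1 hw) (v / τ)).comp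
          (f := fun w : ℂ ↦ w / τ) w (by fun_prop)
      have h3 := hr w
      rw [show f = _ from funext hf]
      fun_prop
    · have h1 := isBigO_mul_mu hτ v
      have ht : Tendsto (fun w : ℂ ↦ w / τ) (𝓝[≠] 0) (𝓝[≠] 0) := by
        refine tendsto_nhdsWithin_iff.2 ⟨?_, ?_⟩
        · exact (Continuous.tendsto' (by fun_prop) _ _ (by simp)).mono_left nhdsWithin_le_nhds
        · filter_upwards [self_mem_nhdsWithin] with w hw
          exact div_ne_zero hw h0
      have h2 := (isBigO_mul_mu hτ' (v / τ)).comp_tendsto ht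
      have hc {g : ℂ → ℂ} (hg : ContinuousAt g 0) : g =O[𝓝[≠] 0] fun _ ↦ (1 : ℂ) :=
        (hg.tendsto.isBigO_one ℂ).mono nhdsWithin_le_nhds
      have h3 := (hc (g := fun w ↦ τ / invFactor τ * exp (π * I * (w - v) ^ 2 / τ))
        (by fun_prop)).mul h2
      have h4 := hc (g := fun w ↦ w * (I / 2 * (R (w - v) τ + 1 / invFactor τ *
        exp (π * I * (w - v) ^ 2 / τ) * R ((w - v) / τ) (-1 / τ))))
        (continuousAt_id.mul (continuousAt_const.mul (hr 0).continuousAt))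
      have h3' := h3.congr_right (g₂ := fun _ ↦ (1 : ℂ)) fun w ↦ by simp
      refine ((h1.add h3').add h4).congr_left fun w ↦ ?_
      rw [hf]
      simp only [Function.comp_apply]
      field_simp
    · intro w hw
      have hw' : (w + 1) / τ ∉ lattice (-1 / τ) :=
        mt (fun h ↦ add_one_mem_lattice_iff.1 ((div_mem_lattice_iff h0 _).1 h)) hw
      have h1 := muTilde_add_self hτ' hw' hv'
      rw [show (w + 1) / τ + -1 / τ = w / τ by field_simp; ring] at h1
      have h2 : exp (π * I * (w + 1 - v) ^ 2 / τ) = exp (π * I * (w - v) ^ 2 / τ) *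
          exp (π * I * (-1 / τ) + 2 * π * I * ((w + 1) / τ - v / τ)) := by
        rw [← Complex.exp_add]
        congr 1
        field_simp
        ring
      simp only [f]
      rw [muTilde_add_one, h1, h2]
      ring
    · intro w hw
      have h2 : exp (π * I * (w + τ - v) ^ 2 / τ) = exp (π * I * (w - v) ^ 2 / τ) *
          exp (π * I * τ + 2 * π * I * (w - v)) := by
        rw [← Complex.exp_add]
        congr 1
        field_simp
        ring
      simp only [f]
      rw [muTilde_add_self hτ hw hv, show (w + τ) / τ = w / τ + 1 by field_simp,
        muTilde_add_one, h2]
      ring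
  have hfu : f u = 0 := (mul_eq_zero.1 hzero).resolve_left (vartheta_ne_zero hτ hu)
  have he : exp (-π * I * (u - v) ^ 2 / τ) * exp (π * I * (u - v) ^ 2 / τ) = 1 := by
    rw [← Complex.exp_add, ← Complex.exp_zero]
    ring_nf
  simp only [f] at hfu
  generalize exp (-π * I * (u - v) ^ 2 / τ) = x₁ at *
  generalize exp (π * I * (u - v) ^ 2 / τ) = x₂ at *
  generalize muTilde (u / τ) (v / τ) (-1 / τ) = M at *
  field_simp at hfu
  linear_combination x₁ * hfu - M * he

/-! ### Modular transformations of `μ̃` -/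

/-- The automorphy factor `γτ + δ`. -/
def autFactor (A : SL(2, ℤ)) (τ : ℂ) : ℂ := (A 1 0 : ℂ) * τ + (A 1 1 : ℂ)

lemma autFactor_ne_zero (A : SL(2, ℤ)) (τ : ℍ) : autFactor A τ ≠ 0 := by
  rw [autFactor, ← ModularGroup.denom_apply]
  exact UpperHalfPlane.denom_ne_zero _ _

lemma coe_smul_eq (A : SL(2, ℤ)) (τ : ℍ) :
    ((A • τ : ℍ) : ℂ) = ((A 0 0 : ℂ) * τ + (A 0 1 : ℂ)) / autFactor A τ := by
  rw [UpperHalfPlane.coe_specialLinearGroup_apply]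
  simp [autFactor]

lemma coe_smul_mul_autFactor (A : SL(2, ℤ)) (τ : ℍ) :
    ((A • τ : ℍ) : ℂ) * autFactor A τ = (A 0 0 : ℂ) * τ + (A 0 1 : ℂ) := by
  rw [coe_smul_eq, div_mul_cancel₀ _ (autFactor_ne_zero A τ)]

lemma det_cast (A : SL(2, ℤ)) : (A 0 0 : ℂ) * A 1 1 - A 0 1 * A 1 0 = 1 := by
  have h := Matrix.det_fin_two A.1
  rw [A.2] at h
  exact_mod_cast h.symm

lemma autFactor_mul (A B : SL(2, ℤ)) (τ : ℍ) :
    autFactor (A * B) τ = autFactor A ((B • τ : ℍ) : ℂ) * autFactor B τ := by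
  have h := coe_smul_mul_autFactor B τ
  rw [autFactor, autFactor, add_mul, mul_assoc, h, autFactor]
  simp only [Matrix.SpecialLinearGroup.coe_mul, Matrix.mul_apply, Fin.sum_univ_two]
  push_cast
  ring

/-- Multiplication by γτ + δ sends the basis 1, Aτ to γτ + δ, ατ + β, which is again a basis of the
lattice of τ because the determinant is 1. -/
lemma div_autFactor_mem_lattice_iff (A : SL(2, ℤ)) (τ : ℍ) (z : ℂ) :
    z / autFactor A τ ∈ lattice ((A • τ : ℍ) : ℂ) ↔ z ∈ lattice τ := by
  have hj := autFactor_ne_zero A τ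
  have hT := coe_smul_mul_autFactor A τ
  have hd := det_cast A
  constructor
  · rintro ⟨m, n, h⟩
    refine ⟨m * A 1 1 + n * A 0 1, m * A 1 0 + n * A 0 0, ?_⟩
    rw [div_eq_iff hj] at h
    rw [h, add_mul, mul_assoc, hT, autFactor]
    push_cast
    ring
  · rintro ⟨m, n, rfl⟩
    refine ⟨m * A 0 0 - n * A 0 1, n * A 1 1 - m * A 1 0, ?_⟩
    rw [div_eq_iff hj, add_mul, mul_assoc, hT, autFactor]
    push_cast
    linear_combination (-(m : ℂ) - n * τ) * hd

lemma sqrt_sq {z : ℂ} (hz : z ≠ 0) : Complex.sqrt z ^ 2 = z := by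
  rw [sqrt_eq_exp hz, ← Complex.exp_nat_mul]
  have : ((2 : ℕ) : ℂ) * (Complex.log z / 2) = Complex.log z := by
    push_cast
    ring
  rw [this, Complex.exp_log hz]

lemma invFactor_eq_sqrt_div {τ : ℂ} (hτ : 0 < τ.im) :
    invFactor τ = Complex.sqrt τ / Complex.sqrt I := by
  have h0 : τ ≠ 0 := by
    rintro rfl
    simp at hτ
  have harg := Complex.arg_mem_Ioc τ
  have harg0 : 0 ≤ τ.arg := Complex.arg_nonneg_iff.2 hτ.le
  -- No branch jump occurs: arg τ ≥ 0 and arg(-i) = -π/2 keep the sum inside (-π, π].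
  have hlog : Complex.log (-I * τ) = Complex.log (-I) + Complex.log τ := by
    refine (Complex.log_mul_eq_add_log_iff (by simp) h0).2 ?_
    rw [Complex.arg_neg_I]
    exact ⟨by linarith [Real.pi_pos], by linarith [Real.pi_pos, harg.2]⟩
  rw [invFactor, Complex.cpow_def_of_ne_zero (by simp [h0]), hlog, sqrt_eq_exp h0,
    sqrt_eq_exp Complex.I_ne_zero, ← Complex.exp_sub, Complex.log_neg_I, Complex.log_I]
  ring_nf

lemma eta_inversion {τ : ℂ} (hτ : 0 < τ.im) :
    ModularForm.eta (-1 / τ) = invFactor τ * ModularForm.eta τ := by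
  have h := ModularForm.eta_comp_eq_csqrt_I_inv (show τ ∈ UpperHalfPlane.upperHalfPlaneSet from hτ)
  rw [invFactor_eq_sqrt_div hτ]
  simp only [Function.comp_apply, Pi.smul_apply, Pi.mul_apply, smul_eq_mul] at h
  rw [h]
  ring

lemma eta_add_one (τ : ℂ) :
    ModularForm.eta (τ + 1) = exp (π * I / 12) * ModularForm.eta τ := by
  have hq (n : ℕ) : ModularForm.eta_q n (τ + 1) = ModularForm.eta_q n τ := by
    rw [ModularForm.eta_q_eq_cexp, ModularForm.eta_q_eq_cexp, Complex.exp_eq_exp_iff_exists_int]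
    exact ⟨n + 1, by push_cast; ring⟩
  have h24 : Function.Periodic.qParam 24 (τ + 1) =
      exp (π * I / 12) * Function.Periodic.qParam 24 τ := by
    rw [Function.Periodic.qParam, Function.Periodic.qParam, ← Complex.exp_add]
    push_cast
    ring_nf
  simp only [ModularForm.eta, hq, h24]
  ring

/-- The transformation law of `η³ μ̃` under `A`. -/
def TransformsUnder (A : SL(2, ℤ)) : Prop :=
  ∀ (τ : ℍ) (u v : ℂ), u ∉ lattice τ → v ∉ lattice τ →
    ModularForm.eta ((A • τ : ℍ) : ℂ) ^ 3 *
        muTilde (u / autFactor A τ) (v / autFactor A τ) ((A • τ : ℍ) : ℂ) =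
      autFactor A τ ^ 2 * exp (-π * I * (A 1 0 : ℂ) * (u - v) ^ 2 / autFactor A τ) *
        (ModularForm.eta τ ^ 3 * muTilde u v τ)

lemma transformsUnder_S : TransformsUnder ModularGroup.S := by
  intro τ u v hu hv
  have hτ : 0 < (τ : ℂ).im := τ.2
  have hj : autFactor ModularGroup.S τ = τ := by simp [autFactor, ModularGroup.S]
  have hS : ((ModularGroup.S • τ : ℍ) : ℂ) = -1 / τ := by
    rw [coe_smul_eq, hj]
    simp [ModularGroup.S]
  have h10 : ((ModularGroup.S 1 0 : ℤ) : ℂ) = 1 := by simp [ModularGroup.S]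
  rw [hj, hS, h10, mul_one, eta_inversion hτ, muTilde_inversion hτ hu hv]
  have h4 : invFactor (τ : ℂ) ^ 4 = -(τ : ℂ) ^ 2 := by
    have := invFactor_sq (τ : ℂ)
    calc invFactor (τ : ℂ) ^ 4 = (invFactor (τ : ℂ) ^ 2) ^ 2 := by ring
      _ = -(τ : ℂ) ^ 2 := by rw [this, mul_pow, neg_sq, Complex.I_sq]; ring
  linear_combination (-(ModularForm.eta (τ : ℂ) ^ 3 * muTilde u v τ *
    exp (-π * I * (u - v) ^ 2 / τ))) * h4

lemma transformsUnder_T : TransformsUnder ModularGroup.T := by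
  intro τ u v hu hv
  have hj : autFactor ModularGroup.T τ = 1 := by simp [autFactor, ModularGroup.T]
  have hT : ((ModularGroup.T • τ : ℍ) : ℂ) = τ + 1 := by
    rw [coe_smul_eq, hj]
    simp [ModularGroup.T]
  have h10 : ((ModularGroup.T 1 0 : ℤ) : ℂ) = 0 := by simp [ModularGroup.T]
  rw [hj, hT, h10, eta_add_one, div_one, div_one, muTilde_add_one_modulus, mul_pow,
    ← Complex.exp_nat_mul]
  have h : exp (((3 : ℕ) : ℂ) * (π * I / 12)) * exp (-π * I / 4) = 1 := by
    rw [← Complex.exp_add, ← Complex.exp_zero]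
    push_cast
    ring_nf
  simp only [mul_zero, zero_mul, zero_div, Complex.exp_zero, one_pow, one_mul]
  linear_combination (ModularForm.eta (τ : ℂ) ^ 3 * muTilde u v τ) * h

lemma transformsUnder_one : TransformsUnder 1 := by
  intro τ u v _ _
  simp [autFactor]

/-- The weight-two factors multiply by the cocycle relation and the quadratic exponents add. No
multiplier system has to be composed, which is why the law is stated for `η³ μ̃`. -/
lemma TransformsUnder.mul {A B : SL(2, ℤ)} (hA : TransformsUnder A) (hB : TransformsUnder B) :
    TransformsUnder (A * B) := by
  intro τ u v hu hv
  have hjA := autFactor_ne_zero A (B • τ)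
  have hjB := autFactor_ne_zero B τ
  have hjAB := autFactor_mul A B τ
  have h1 := hA (B • τ) _ _ (mt (div_autFactor_mem_lattice_iff B τ u).1 hu)
    (mt (div_autFactor_mem_lattice_iff B τ v).1 hv)
  rw [hB τ u v hu hv, div_div, div_div, mul_comm (autFactor B τ), ← hjAB, ← mul_smul] at h1
  rw [h1]
  have hexp : exp (-π * I * (A 1 0 : ℂ) * (u / autFactor B τ - v / autFactor B τ) ^ 2 /
      autFactor A ((B • τ : ℍ) : ℂ)) * exp (-π * I * (B 1 0 : ℂ) * (u - v) ^ 2 / autFactor B τ) =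
      exp (-π * I * ((A * B) 1 0 : ℤ) * (u - v) ^ 2 / autFactor (A * B) τ) := by
    rw [← Complex.exp_add]
    congr 1
    have hAB : (((A * B) 1 0 : ℤ) : ℂ) = A 1 0 * B 0 0 + A 1 1 * B 1 0 := by
      simp [Matrix.mul_apply, Fin.sum_univ_two]
    have key : (A 1 0 : ℂ) + B 1 0 * autFactor B τ * autFactor A ((B • τ : ℍ) : ℂ) =
        (A 1 0 * B 0 0 + A 1 1 * B 1 0) * autFactor B τ := by
      have hT := coe_smul_mul_autFactor B τ
      have hd := det_cast B
      have h2 : autFactor A ((B • τ : ℍ) : ℂ) = A 1 0 * ((B • τ : ℍ) : ℂ) + A 1 1 := rfl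
      have h3 : autFactor B τ = B 1 0 * (τ : ℂ) + B 1 1 := rfl
      linear_combination (B 1 0 * autFactor B τ) * h2 + (B 1 0 * A 1 0 : ℂ) * hT
        - (A 1 0 * B 0 0 : ℂ) * h3 - (A 1 0 : ℂ) * hd
    rw [hjAB, hAB, ← sub_div]
    field_simp
    linear_combination (-(u - v) ^ 2) * key
  rw [hjAB] at hexp ⊢
  rw [← hexp]
  ring

lemma TransformsUnder.inv {A : SL(2, ℤ)} (hA : TransformsUnder A) : TransformsUnder A⁻¹ := by
  intro τ u v hu hv
  have hj := autFactor_ne_zero A⁻¹ τ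
  have hjj : autFactor A ((A⁻¹ • τ : ℍ) : ℂ) * autFactor A⁻¹ τ = 1 := by
    rw [← autFactor_mul, mul_inv_cancel]
    simp [autFactor]
  have hjA : autFactor A ((A⁻¹ • τ : ℍ) : ℂ) = (autFactor A⁻¹ τ)⁻¹ := eq_inv_of_mul_eq_one_left hjj
  have h1 := hA (A⁻¹ • τ) _ _ (mt (div_autFactor_mem_lattice_iff A⁻¹ τ u).1 hu)
    (mt (div_autFactor_mem_lattice_iff A⁻¹ τ v).1 hv)
  rw [smul_inv_smul, hjA, div_inv_eq_mul, div_inv_eq_mul, div_mul_cancel₀ _ hj,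
    div_mul_cancel₀ _ hj] at h1
  rw [h1]
  have h10 : ((A⁻¹ 1 0 : ℤ) : ℂ) = -A 1 0 := by
    simp [Matrix.SpecialLinearGroup.SL2_inv_expl]
  have hexp : exp (-π * I * ((A⁻¹ 1 0 : ℤ) : ℂ) * (u - v) ^ 2 / autFactor A⁻¹ τ) *
      exp (-π * I * (A 1 0 : ℂ) * (u / autFactor A⁻¹ τ - v / autFactor A⁻¹ τ) ^ 2 /
        (autFactor A⁻¹ τ)⁻¹) = 1 := by
    rw [← Complex.exp_add, ← Complex.exp_zero, h10]
    congr 1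
    field_simp
    ring
  generalize exp (-π * I * ((A⁻¹ 1 0 : ℤ) : ℂ) * (u - v) ^ 2 / autFactor A⁻¹ τ) = x₁ at *
  generalize exp (-π * I * (A 1 0 : ℂ) * (u / autFactor A⁻¹ τ - v / autFactor A⁻¹ τ) ^ 2 /
        (autFactor A⁻¹ τ)⁻¹) = x₂ at *
  generalize muTilde _ _ _ = M
  field_simp
  linear_combination (-(ModularForm.eta ((A⁻¹ • τ : ℍ) : ℂ) ^ 3 * M)) * hexp

theorem transformsUnder (A : SL(2, ℤ)) : TransformsUnder A := by
  have h : A ∈ Subgroup.closure {ModularGroup.S, ModularGroup.T} := by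
    simp [SpecialLinearGroup.SL2Z_generators]
  induction h using Subgroup.closure_induction with
  | one => exact transformsUnder_one
  | mem g hg =>
    rcases hg with rfl | rfl
    · exact transformsUnder_S
    · exact transformsUnder_T
  | mul A B _ _ hA hB => exact hA.mul hB
  | inv A _ hA => exact hA.inv

/-- The transformation law of `μ̃` under the modular group. -/
theorem muTilde_smul (A : SL(2, ℤ)) (τ : ℍ) {u v : ℂ} (hu : u ∉ lattice τ) (hv : v ∉ lattice τ) :
    muTilde (u / autFactor A τ) (v / autFactor A τ) ((A • τ : ℍ) : ℂ) =
      etaMultiplier A ^ (-3 : ℤ) * Complex.sqrt (autFactor A τ) *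
        exp (-π * I * (A 1 0 : ℂ) * (u - v) ^ 2 / autFactor A τ) * muTilde u v τ := by
  have h := transformsUnder A τ u v hu hv
  have hη : ModularForm.eta (τ : ℂ) ≠ 0 := ModularForm.eta_ne_zero τ.2
  have hηA : ModularForm.eta ((A • τ : ℍ) : ℂ) ≠ 0 := ModularForm.eta_ne_zero (A • τ).2
  have hspec := etaMultiplier_spec A τ
  change _ = etaMultiplier A * Complex.sqrt (autFactor A τ) * _ at hspec
  have hsq := sqrt_sq (autFactor_ne_zero A τ)
  have hν : etaMultiplier A ≠ 0 := by
    intro h0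
    rw [h0, zero_mul, zero_mul] at hspec
    exact hηA hspec
  have hs : Complex.sqrt (autFactor A τ) ≠ 0 := by
    intro h0
    rw [h0, mul_zero, zero_mul] at hspec
    exact hηA hspec
  rw [hspec] at h
  generalize exp (-π * I * (A 1 0 : ℂ) * (u - v) ^ 2 / autFactor A τ) = x at *
  generalize muTilde (u / autFactor A τ) (v / autFactor A τ) ((A • τ : ℍ) : ℂ) = M at *
  generalize Complex.sqrt (autFactor A τ) = s at *
  -- Writing γτ + δ = s², the weight factor becomes s⁴ and `η³` at Aτ contributes s³, leaving a
  -- single square root.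
  rw [← hsq] at h
  rw [zpow_neg, show (3 : ℤ) = ((3 : ℕ) : ℤ) by norm_num, zpow_natCast]
  field_simp
  have hne : s ^ 3 * ModularForm.eta (τ : ℂ) ^ 3 ≠ 0 :=
    mul_ne_zero (pow_ne_zero _ hs) (pow_ne_zero _ hη)
  refine mul_left_cancel₀ hne ?_
  linear_combination h

lemma muTilde_add_int_right (u v τ : ℂ) (n : ℤ) :
    muTilde u (v + n) τ = (-1) ^ n * muTilde u v τ := by
  induction n using Int.induction_on with
  | zero => simp
  | succ k ih =>
    rw [show v + ((k + 1 : ℤ) : ℂ) = v + ((k : ℤ) : ℂ) + 1 by push_cast; ring,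
      muTilde_add_one_right, ih, zpow_add_one₀ (by norm_num)]
    ring
  | pred k ih =>
    have h := muTilde_add_one_right u (v + ((-k - 1 : ℤ) : ℂ)) τ
    rw [show v + ((-k - 1 : ℤ) : ℂ) + 1 = v + ((-k : ℤ) : ℂ) by push_cast; ring, ih] at h
    rw [zpow_sub_one₀ (by norm_num), show (-1 : ℂ)⁻¹ = -1 by norm_num]
    linear_combination h

lemma muTilde_add_int_mul_right {τ u v : ℂ} (hτ : 0 < τ.im) (hu : u ∉ lattice τ)
    (hv : v ∉ lattice τ) (m : ℤ) :
    muTilde u (v + m * τ) τ =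
      (-1) ^ m * exp (π * I * m ^ 2 * τ - 2 * π * I * m * (u - v)) * muTilde u v τ := by
  have hmem (m : ℤ) : v + m * τ ∉ lattice τ := by
    have := add_mem_lattice_iff (τ := τ) (z := v) 0 m
    rw [Int.cast_zero, zero_add] at this
    rwa [this]
  have step (m : ℤ) := muTilde_add_self_right hτ hu (hmem m)
  induction m using Int.induction_on with
  | zero => simp
  | succ k ih =>
    have h := step k
    rw [ih] at h
    rw [show v + ((k + 1 : ℤ) : ℂ) * τ = v + ((k : ℤ) : ℂ) * τ + τ by push_cast; ring, h,
      zpow_add_one₀ (by norm_num)]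
    have he : exp (π * I * τ - 2 * π * I * (u - (v + ((k : ℤ) : ℂ) * τ))) *
        exp (π * I * ((k : ℤ) : ℂ) ^ 2 * τ - 2 * π * I * ((k : ℤ) : ℂ) * (u - v)) =
        exp (π * I * ((k + 1 : ℤ) : ℂ) ^ 2 * τ - 2 * π * I * ((k + 1 : ℤ) : ℂ) * (u - v)) := by
      rw [← Complex.exp_add]
      push_cast
      ring_nf
    rw [← he]
    ring
  | pred k ih =>
    have h := step (-k - 1)
    rw [show v + ((-k - 1 : ℤ) : ℂ) * τ + τ = v + ((-k : ℤ) : ℂ) * τ by push_cast; ring, ih] at h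
    rw [zpow_sub_one₀ (by norm_num), show (-1 : ℂ)⁻¹ = -1 by norm_num]
    have he : exp (π * I * τ - 2 * π * I * (u - (v + ((-k - 1 : ℤ) : ℂ) * τ))) *
        exp (π * I * ((-k - 1 : ℤ) : ℂ) ^ 2 * τ - 2 * π * I * ((-k - 1 : ℤ) : ℂ) * (u - v)) =
        exp (π * I * ((-k : ℤ) : ℂ) ^ 2 * τ - 2 * π * I * ((-k : ℤ) : ℂ) * (u - v)) := by
      rw [← Complex.exp_add]
      push_cast
      ring_nf
    rw [← he] at h
    have hne := Complex.exp_ne_zero (π * I * τ - 2 * π * I * (u - (v + ((-k - 1 : ℤ) : ℂ) * τ)))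
    refine mul_left_cancel₀ hne ?_
    linear_combination h

/-! ### The transformation of `N` -/

lemma div_notMem_lattice {a c : ℤ} (hc : 0 < c) (hac : ¬ c ∣ 2 * a) {τ : ℂ} (hτ : 0 < τ.im) :
    (2 * a / c : ℂ) ∉ lattice τ := by
  rintro ⟨m, n, h⟩
  have hcC : (c : ℂ) ≠ 0 := by exact_mod_cast hc.ne'
  have him := congrArg Complex.im h
  have hr : (2 * a / c : ℂ) = ((2 * a / c : ℝ) : ℂ) := by push_cast; rfl
  rw [hr, Complex.ofReal_im] at him
  have hn : n = 0 := by simpa [hτ.ne'] using him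
  rw [hn, Int.cast_zero, zero_mul, add_zero, div_eq_iff hcC] at h
  refine hac ⟨m, ?_⟩
  have : 2 * a = m * c := by exact_mod_cast h
  rw [this, mul_comm]

lemma self_notMem_lattice_two_mul {τ : ℂ} (hτ : 0 < τ.im) : τ ∉ lattice (2 * τ) := by
  rintro ⟨m, n, h⟩
  have him := congrArg Complex.im h
  have h1 : τ.im = n * (2 * τ.im) := by simpa using him
  have h2 : (1 : ℝ) = 2 * n := by
    have : τ.im * (1 - 2 * n) = 0 := by linear_combination h1
    rcases mul_eq_zero.1 this with h | h
    · exact absurd h hτ.ne'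
    · linear_combination h
  have h3 : (1 : ℤ) = 2 * n := by exact_mod_cast h2
  omega

/-- `N(a,c;Aτ)` in terms of a matrix `B` that maps a given point to twice `Aτ`. -/
lemma N_smul_of_coe_smul_eq {a c : ℤ} (hc : 0 < c) (hac : ¬ c ∣ 2 * a) (A B : SL(2, ℤ))
    (τ τ' : ℍ) (hB : ((B • τ' : ℍ) : ℂ) = 2 * ((A • τ : ℍ) : ℂ)) :
    (2 * a / c : ℂ) * autFactor B τ' ∉ lattice τ' ∧
    N a c (A • τ) = etaMultiplier B ^ (-3 : ℤ) * Complex.sqrt (autFactor B τ') *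
      exp (-π * I * (((A • τ : ℍ) : ℂ) / 2
        + (B 1 0 : ℂ) * autFactor B τ' * (2 * a / c - ((A • τ : ℍ) : ℂ)) ^ 2)) *
      muTilde (2 * a / c * autFactor B τ') (((A • τ : ℍ) : ℂ) * autFactor B τ') τ' := by
  have hj := autFactor_ne_zero B τ'
  have hu : (2 * a / c : ℂ) * autFactor B τ' ∉ lattice τ' := by
    -- The condition c ∤ 2a enters here: it keeps the real number 2a/c out of every lattice ℤ + ℤσ
    -- with Im σ > 0.
    rw [← div_autFactor_mem_lattice_iff B, mul_div_cancel_right₀ _ hj]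
    exact div_notMem_lattice hc hac (B • τ').2
  have hv : ((A • τ : ℍ) : ℂ) * autFactor B τ' ∉ lattice τ' := by
    rw [← div_autFactor_mem_lattice_iff B, mul_div_cancel_right₀ _ hj, hB]
    exact self_notMem_lattice_two_mul (A • τ).2
  have h := muTilde_smul B τ' hu hv
  rw [mul_div_cancel_right₀ _ hj, mul_div_cancel_right₀ _ hj, hB] at h
  refine ⟨hu, ?_⟩
  rw [N, h]
  have he : exp (-π * I * ((A • τ : ℍ) : ℂ) / 2) * exp (-π * I * (B 1 0 : ℂ) *
      (2 * a / c * autFactor B τ' - ((A • τ : ℍ) : ℂ) * autFactor B τ') ^ 2 / autFactor B τ') =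
      exp (-π * I * (((A • τ : ℍ) : ℂ) / 2
        + (B 1 0 : ℂ) * autFactor B τ' * (2 * a / c - ((A • τ : ℍ) : ℂ)) ^ 2)) := by
    rw [← Complex.exp_add, ← sub_mul]
    congr 1
    field_simp
    ring
  rw [← he]
  ring

/-- In both cases of the proposition, the lower-left entry of B times its automorphy factor is γ(γτ
+ δ)/2, so one identity serves both. The denominators cancel because 1 + γ(ατ + β) = α(γτ + δ), by
the determinant. -/
lemma half_add_mul_sq_eq (A : SL(2, ℤ)) (τ : ℍ) (r : ℂ) :
    ((A • τ : ℍ) : ℂ) / 2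
      + (A 1 0 : ℂ) / 2 * autFactor A τ * (r - ((A • τ : ℍ) : ℂ)) ^ 2 =
      A 1 0 / 2 * autFactor A τ * r ^ 2 - A 1 0 * r * (A 0 0 * τ + A 0 1)
        + A 0 0 * (A 0 0 * τ + A 0 1) / 2 := by
  have hT := coe_smul_mul_autFactor A τ
  have hd := det_cast A
  have hj : autFactor A τ = A 1 0 * (τ : ℂ) + A 1 1 := rfl
  generalize ((A • τ : ℍ) : ℂ) = T at *
  linear_combination (-(A 1 0 : ℂ) * r + A 1 0 / 2 * T + A 0 0 / 2) * hT
    - T / 2 * hd - A 0 0 / 2 * T * hj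

/-- Scaling by a positive real does not change the argument, so the principal branch is respected.
-/
lemma sqrt_div_two {z : ℂ} (hz : z ≠ 0) :
    Complex.sqrt (z / 2) = (2 : ℂ) ^ (-1 / 2 : ℂ) * Complex.sqrt z := by
  have h2 : ((2⁻¹ : ℝ) : ℂ) * z = z / 2 := by push_cast; ring
  rw [← h2, sqrt_eq_exp (by simpa using hz), sqrt_eq_exp hz,
    Complex.log_ofReal_mul (by norm_num) hz, Complex.cpow_def_of_ne_zero two_ne_zero,
    ← Complex.exp_add, Real.log_inv, show (2 : ℂ) = ((2 : ℝ) : ℂ) by norm_num,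
    ← Complex.ofReal_log (by norm_num)]
  push_cast
  ring_nf

lemma N_smul_of_even {a c : ℤ} (hc : 0 < c) (hac : ¬ c ∣ 2 * a) (A : SL(2, ℤ))
    (τ : ℍ) (hγ : 2 ∣ A 1 0) :
    N a c (A • τ) =
      etaMultiplier (upperTwist 2 A hγ) ^ (-3 : ℤ)
        * (-1 : ℂ) ^ (A 0 1 + (A 0 0 - 1) / 2)
        * exp (-π * I * (2 * a ^ 2 * A 1 0 * A 1 1 / c ^ 2 + 2 * a / c + A 0 0 * A 0 1 / 2
            - 2 * a * A 1 1 / c))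
        * exp (-π * I * τ * (2 * a ^ 2 * A 1 0 ^ 2 / c ^ 2 - 2 * a * A 1 0 / c + 1 / 2))
        * Complex.sqrt (A 1 0 * τ + A 1 1)
        * muTilde (2 * a * A 1 1 / c + 2 * a * A 1 0 * τ / c) τ (2 * τ) := by
  have hd := det_cast A
  have hdZ : A 0 0 * A 1 1 - A 0 1 * A 1 0 = 1 := by exact_mod_cast hd
  obtain ⟨g, hg⟩ := id hγ
  -- With γ even, determinant 1 forces α to be odd; m = (α - 1)/2 counts the shifts of v by the
  -- period 2τ.
  obtain ⟨m, hm⟩ : ∃ m, A 0 0 = 2 * m + 1 := by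
    rcases Int.even_or_odd' (A 0 0) with ⟨m, hm | hm⟩
    · exfalso
      rw [hm, hg] at hdZ
      have : 2 * (m * A 1 1 - A 0 1 * g) = 1 := by linear_combination hdZ
      omega
    · exact ⟨m, hm⟩
  have hm2 : (A 0 0 - 1) / 2 = m := by rw [hm]; omega
  have hτ2 : 0 < (2 * (τ : ℂ)).im := by simpa using τ.2
  let τ' : ℍ := ⟨2 * τ, hτ2⟩
  have hτ' : (τ' : ℂ) = 2 * τ := rfl
  have h00 : (upperTwist 2 A hγ) 0 0 = A 0 0 := rfl
  have h01 : (upperTwist 2 A hγ) 0 1 = 2 * A 0 1 := rfl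
  have h10 : (upperTwist 2 A hγ) 1 0 = g := by
    change A 1 0 / 2 = g
    rw [hg]; omega
  have h11 : (upperTwist 2 A hγ) 1 1 = A 1 1 := rfl
  have hgC : (A 1 0 : ℂ) = 2 * g := by exact_mod_cast hg
  have hmC : (A 0 0 : ℂ) = 2 * m + 1 := by exact_mod_cast hm
  have hjB : autFactor (upperTwist 2 A hγ) τ' = autFactor A τ := by
    rw [autFactor, autFactor, h10, h11, hτ', hgC]
    ring
  have hB : (((upperTwist 2 A hγ) • τ' : ℍ) : ℂ) = 2 * ((A • τ : ℍ) : ℂ) := by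
    rw [coe_smul_eq, coe_smul_eq, hjB, h00, h01, hτ']
    push_cast
    ring
  obtain ⟨hu, hN⟩ := N_smul_of_coe_smul_eq hc hac A (upperTwist 2 A hγ) τ τ' hB
  rw [hN, hjB, h10, coe_smul_mul_autFactor, hτ']
  rw [hjB, hτ'] at hu
  have hgh : (g : ℂ) = A 1 0 / 2 := by rw [hgC]; ring
  have hv : (A 0 0 : ℂ) * τ + A 0 1 = τ + m * (2 * τ) + A 0 1 := by
    rw [hmC]; ring
  rw [hgh, half_add_mul_sq_eq, hv, muTilde_add_int_right,
    muTilde_add_int_mul_right hτ2 hu (self_notMem_lattice_two_mul τ.2), hm2,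
    zpow_add₀ (by norm_num : (-1 : ℂ) ≠ 0)]
  have hj : autFactor A τ = A 1 0 * (τ : ℂ) + A 1 1 := rfl
  have hu' : (2 * a / c : ℂ) * autFactor A τ = 2 * a * A 1 1 / c + 2 * a * A 1 0 * τ / c := by
    rw [hj]
    ring
  have hexp : exp (-π * I * (A 1 0 / 2 * autFactor A τ * (2 * a / c) ^ 2
        - A 1 0 * (2 * a / c) * (τ + m * (2 * τ) + A 0 1)
        + A 0 0 * (τ + m * (2 * τ) + A 0 1) / 2)) *
      exp (π * I * m ^ 2 * (2 * τ) - 2 * π * I * m * (2 * a / c * autFactor A τ - τ)) =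
      exp (-π * I * (2 * a ^ 2 * A 1 0 * A 1 1 / c ^ 2 + 2 * a / c + A 0 0 * A 0 1 / 2
            - 2 * a * A 1 1 / c)) *
      exp (-π * I * τ * (2 * a ^ 2 * A 1 0 ^ 2 / c ^ 2 - 2 * a * A 1 0 / c + 1 / 2)) := by
    rw [← Complex.exp_add, ← Complex.exp_add, hj]
    congr 1
    rw [hmC] at hd ⊢
    -- The determinant relation trades βγ for αδ - 1, which produces the isolated term 2a/c in the
    -- exponent.
    linear_combination (-2 * π * I * a / c) * hd
  rw [← hu', ← hj]
  linear_combination (etaMultiplier (upperTwist 2 A hγ) ^ (-3 : ℤ) * Complex.sqrt (autFactor A τ) *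
    ((-1) ^ (A 0 1) * (-1) ^ m) *
    muTilde (2 * a / c * autFactor A τ) τ (2 * τ)) * hexp

lemma N_smul_of_even_right {a c : ℤ} (hc : 0 < c) (hac : ¬ c ∣ 2 * a) (A : SL(2, ℤ))
    (τ : ℍ) (hδ : 2 ∣ A 1 1) :
    N a c (A • τ) =
      (2 : ℂ) ^ (-1 / 2 : ℂ)
        * etaMultiplier (lowerTwist 2 A hδ) ^ (-3 : ℤ)
        * exp (-π * I * (2 * a ^ 2 * A 1 0 * A 1 1 / c ^ 2 - 2 * a * A 0 1 * A 1 0 / c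
            + A 0 0 * A 0 1 / 2))
        * exp (-π * I * τ * (2 * a ^ 2 * A 1 0 ^ 2 / c ^ 2 - 2 * a * A 0 0 * A 1 0 / c
            + A 0 0 ^ 2 / 2))
        * Complex.sqrt (A 1 0 * τ + A 1 1)
        * muTilde (a * A 1 1 / c + a * A 1 0 * τ / c) (A 0 0 * τ / 2 + A 0 1 / 2) (τ / 2) := by
  obtain ⟨d, hd⟩ := id hδ
  have hτ2 : 0 < ((τ : ℂ) / 2).im := by
    rw [Complex.div_ofNat_im]
    exact half_pos τ.2
  let τ' : ℍ := ⟨τ / 2, hτ2⟩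
  have hτ' : (τ' : ℂ) = τ / 2 := rfl
  have h00 : (lowerTwist 2 A hδ) 0 0 = 2 * A 0 0 := rfl
  have h01 : (lowerTwist 2 A hδ) 0 1 = A 0 1 := rfl
  have h10 : (lowerTwist 2 A hδ) 1 0 = A 1 0 := rfl
  have h11 : (lowerTwist 2 A hδ) 1 1 = d := by
    change A 1 1 / 2 = d
    rw [hd]; omega
  have hdC : (A 1 1 : ℂ) = 2 * d := by exact_mod_cast hd
  have hj : autFactor A τ = A 1 0 * (τ : ℂ) + A 1 1 := rfl
  have hj0 := autFactor_ne_zero A τ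
  -- This halving is the origin of the factor 2^{-1/2}.
  have hjB : autFactor (lowerTwist 2 A hδ) τ' = autFactor A τ / 2 := by
    rw [autFactor, autFactor, h10, h11, hτ', hdC]
    ring
  have hB : (((lowerTwist 2 A hδ) • τ' : ℍ) : ℂ) = 2 * ((A • τ : ℍ) : ℂ) := by
    rw [coe_smul_eq, coe_smul_eq, hjB, h00, h01, hτ']
    push_cast
    field_simp
  obtain ⟨-, hN⟩ := N_smul_of_coe_smul_eq hc hac A (lowerTwist 2 A hδ) τ τ' hB
  rw [hN, hjB, h10, hτ', ← mul_div_assoc ((A • τ : ℍ) : ℂ), coe_smul_mul_autFactor,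
    sqrt_div_two hj0, ← mul_div_assoc (2 * a / c : ℂ),
    show (A 1 0 : ℂ) * (autFactor A τ / 2) = A 1 0 / 2 * autFactor A τ by ring,
    half_add_mul_sq_eq]
  have hu' : (2 * a / c : ℂ) * autFactor A τ / 2 = a * A 1 1 / c + a * A 1 0 * τ / c := by
    rw [hj]
    ring
  have hv' : ((A 0 0 : ℂ) * τ + A 0 1) / 2 = A 0 0 * τ / 2 + A 0 1 / 2 := by ring
  have hexp : exp (-π * I * (A 1 0 / 2 * autFactor A τ * (2 * a / c) ^ 2
        - A 1 0 * (2 * a / c) * (A 0 0 * τ + A 0 1) + A 0 0 * (A 0 0 * τ + A 0 1) / 2)) =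
      exp (-π * I * (2 * a ^ 2 * A 1 0 * A 1 1 / c ^ 2 - 2 * a * A 0 1 * A 1 0 / c
            + A 0 0 * A 0 1 / 2)) *
      exp (-π * I * τ * (2 * a ^ 2 * A 1 0 ^ 2 / c ^ 2 - 2 * a * A 0 0 * A 1 0 / c
            + A 0 0 ^ 2 / 2)) := by
    rw [← Complex.exp_add, hj]
    ring_nf
  rw [hu', hv', hexp, ← hj]
  ring

end ZwegersMu

end

theorem proposition3p1 (a c : ℤ) (hc : 0 < c) (hac : ¬ c ∣ 2 * a)
    (A : SL(2, ℤ)) (α β γ δ : ℤ) (hA : (A : Matrix (Fin 2) (Fin 2) ℤ) = !![α, β; γ, δ])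
    (τ : ℍ) :
    (∀ hγ : 2 ∣ A 1 0,
      ZwegersMu.N a c (A • τ) =
        ZwegersMu.etaMultiplier (ZwegersMu.upperTwist 2 A hγ) ^ (-3 : ℤ)
          * (-1 : ℂ) ^ (β + (α - 1) / 2)
          * exp (-π * I * (2 * a ^ 2 * γ * δ / c ^ 2 + 2 * a / c + α * β / 2 - 2 * a * δ / c))
          * exp (-π * I * τ * (2 * a ^ 2 * γ ^ 2 / c ^ 2 - 2 * a * γ / c + 1 / 2))
          * Complex.sqrt (γ * τ + δ)
          * ZwegersMu.muTilde (2 * a * δ / c + 2 * a * γ * τ / c) τ (2 * τ)) ∧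
    (Odd γ → ∀ hδ : 2 ∣ A 1 1,
      ZwegersMu.N a c (A • τ) =
        (2 : ℂ) ^ (-1 / 2 : ℂ)
          * ZwegersMu.etaMultiplier (ZwegersMu.lowerTwist 2 A hδ) ^ (-3 : ℤ)
          * exp (-π * I * (2 * a ^ 2 * γ * δ / c ^ 2 - 2 * a * β * γ / c + α * β / 2))
          * exp (-π * I * τ * (2 * a ^ 2 * γ ^ 2 / c ^ 2 - 2 * a * α * γ / c + α ^ 2 / 2))
          * Complex.sqrt (γ * τ + δ)
          * ZwegersMu.muTilde (a * δ / c + a * γ * τ / c) (α * τ / 2 + β / 2) (τ / 2)) := by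
  obtain rfl : A 0 0 = α := congrFun (congrFun hA 0) 0
  obtain rfl : A 0 1 = β := congrFun (congrFun hA 0) 1
  obtain rfl : A 1 0 = γ := congrFun (congrFun hA 1) 0
  obtain rfl : A 1 1 = δ := congrFun (congrFun hA 1) 1
  exact ⟨fun hγ ↦ ZwegersMu.N_smul_of_even hc hac A τ hγ,
    fun _ hδ ↦ ZwegersMu.N_smul_of_even_right hc hac A τ hδ⟩
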